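/- **Setting.** Let $n,T\ge 1$ be integers, $M,\epsilon>0$, $\mathcal K=[0,1]^n$, and let $f_1,\dots,f_T:2^{[n]}\to[-M,M]$ be any fixed sequence of submodular functions, i.e. $f_t(S'\cup\{i\})-f_t(S')\ge f_t(S\cup\{i\})-f_t(S)$ whenever $S'\subseteq S\subseteq[n]$ and $i\in[n]\setminus S$. Write $\|\cdot\|$ for the Euclidean norm, $\mathcal X_S\in\{0,1\}^n$ for the characteristic vector of $S$, and $e_i$ for the standard basis vectors. **Algorithm** $\textsc{BanditSubmodPFTAL}(\{f_t\},M,H,L,[n],\epsilon,\gamma)$. Start with an arbitrary $x_1\in\mathcal K$. In round $t=1,\dots,T$: 1. Find (by any measurable deterministic rule, which may depend on $t$) a maximal chain $\emptyset=B_0\subset B_1\subset\dots\subset B_n=[n]$ such that $x_t=\sum_{i=0}^n\mu_i\mathcal X_{B_i}$ with $\mu_i\ge 0$, $\sum_i\mu_i=1$. Let $b_i$ be the element of $B_i\setminus B_{i-1}$. 2. Play $S_t=B_i$ with probability $\rho_i=(1-\gamma)\mu_i+\frac{\gamma}{n+1}$ and observe only $f_t(S_t)$. 3. If $S_t=B_0$,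 set $\hat g_t=-\frac1{\rho_0}f_t(B_0)e_{b_1}$; if $S_t=B_n$, set $\hat g_t=\frac1{\rho_n}f_t(B_n)e_{b_n}$; if $S_t=B_i$ with $0<i<n$, draw a uniform sign $\xi$ and set $\hat g_t=\frac2{\rho_i}f_t(B_i)e_{b_i}$ if $\xi=+1$ and $\hat g_t=-\frac2{\rho_i}f_t(B_i)e_{b_{i+1}}$ if $\xi=-1$. 4. Pass $z_t=\hat g_t+Hx_t$ to the tree-based aggregation protocol (below) and receive a noisy partial sum $\hat v_t$ of $z_1,\dots,z_t$. 5. Set $x_{t+1}=\arg\min_{x\in\mathcal K}\ \hat v_t^\top x+\frac H2\sum_{\tau=1}^t\|x-x_\tau\|^2$. *Tree-based aggregation.* Keep a complete binary tree of depth $m=\lceil\log_2T\rceil$, all nodes initially $0$. In round $t$, add $z_t$ to every node on the path from the $t$-th leaf to the root. In addition add a fresh independent noise vector, with density on $\mathbb R^n$ proportional to $\exp\bigl(-\frac{\epsilon\|y\|}{L(m+1)}\bigr)$, to each node of this path from the leaf up to and including the first node that is a left child (up to the root if there is none). Then return $\hat v_t$, the sum over all $j$ such that the binary digit of $t$ of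 weight $2^j$ is $1$ of the node at height $j$ on this path, if it is a left child or the root, and of its left sibling otherwise. **Theorem.** There is a constant $k$, and for all $0<c_1\le c_2$ there is a constant $C>0$, such that the following holds for all $n,T\ge1$, all $M,\epsilon>0$ and all $f_1,\dots,f_T$ as above. Let $\gamma=\frac n{T^{1/4}}$, and suppose that $\gamma\le1$ (so that the $\rho_i$ are probabilities). Let $c_1\frac{M}{\sqrt n\,T^{1/4}}\le H\le c_2\frac{M}{\sqrt n\,T^{1/4}}$ and $L=4M+2H\sqrt n$. Then the sets $S_1,\dots,S_T$ played by $\textsc{BanditSubmodPFTAL}$ satisfy $$\mathbb E\Bigl[\sum_{t=1}^Tf_t(S_t)-\min_{S\subseteq[n]}\sum_{t=1}^Tf_t(S)\Bigr]\le C\,(1+\ln T)^k\,M\,n^{3/2}\,T^{3/4}\max\Bigl\{1,\frac1\epsilon\Bigr\},$$ where the expectation is over all randomness of the algorithm. In particular, for $\epsilon\le1$ the expected regret is $\tilde O\bigl(\frac{Mn^{3/2}T^{3/4}}{\epsilon}\bigr)$. -/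

import Mathlib

open MeasureTheory

noncomputable section

namespace BanditSubmodular

/-- Vectors in `ℝⁿ` with the Euclidean norm. -/
abbrev Vec (n : ℕ) : Type := EuclideanSpace ℝ (Fin n)

/-- Diminishing returns. -/
def IsSubmodular {n : ℕ} (f : Finset (Fin n) → ℝ) : Prop :=
  ∀ S' S : Finset (Fin n), S' ⊆ S → ∀ i, i ∉ S →
    f (insert i S) - f S ≤ f (insert i S') - f S'

/-- The cube `𝒦 = [0,1]ⁿ`. -/
def cube (n : ℕ) : Set (Vec n) := {x | ∀ i, x i ∈ Set.Icc (0 : ℝ) 1}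

/-! ### Maximal chains

A maximal chain `∅ = B₀ ⊂ ⋯ ⊂ Bₙ = [n]` is given by the order `π` in which the elements are added:
`π j` is the element at (0-based) position `j`, and `B i` consists of the first `i` elements. -/

/-- The set `B i` of the maximal chain. -/
def chainSet {n : ℕ} (π : Equiv.Perm (Fin n)) (i : ℕ) : Finset (Fin n) :=
  Finset.univ.filter fun e => (π.symm e : ℕ) < i

/-- The sequence `1, x (π 0), …, x (π (n-1)), 0, 0, …`. -/
def chainLevel {n : ℕ} (π : Equiv.Perm (Fin n)) (x : Vec n) : ℕ → ℝ
  | 0 => 1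
  | j + 1 => if h : j < n then x (π ⟨j, h⟩) else 0

/-- The weight `μ i` of `B i` in the decomposition of `x` along the chain
(see `sum_chainWeight` and `sum_chainWeight_chainSet`). -/
def chainWeight {n : ℕ} (π : Equiv.Perm (Fin n)) (x : Vec n) (i : ℕ) : ℝ :=
  chainLevel π x i - chainLevel π x (i + 1)

/-- The weights add up to `1`. -/
theorem sum_chainWeight {n : ℕ} (π : Equiv.Perm (Fin n)) (x : Vec n) :
    ∑ i ∈ Finset.range (n + 1), chainWeight π x i = 1 := by
  unfold chainWeight
  rw [Finset.sum_range_sub']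
  simp [chainLevel]

/-- `x = ∑ i, μ i • 𝒳_{B i}`, coordinate by coordinate. -/
theorem sum_chainWeight_chainSet {n : ℕ} (π : Equiv.Perm (Fin n)) (x : Vec n) (e : Fin n) :
    ∑ i ∈ Finset.range (n + 1), chainWeight π x i * (if e ∈ chainSet π i then 1 else 0) = x e := by
  have h1 : ∀ m, (π.symm e : ℕ) + 1 ≤ m →
      ∑ i ∈ Finset.range m, chainWeight π x i * (if e ∈ chainSet π i then 1 else 0)
        = chainLevel π x ((π.symm e : ℕ) + 1) - chainLevel π x m := by
    intro m hm
    induction m, hm using Nat.le_induction with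
    | base =>
      rw [sub_self]
      refine Finset.sum_eq_zero fun i hi => ?_
      have : ¬ ((π.symm e : ℕ) < i) := by have := Finset.mem_range.1 hi; omega
      simp [chainSet, this]
    | succ m hm ih =>
      have : (π.symm e : ℕ) < m := by omega
      rw [Finset.sum_range_succ, ih]
      simp [chainSet, this, chainWeight]
  rw [h1 (n + 1) (by have := (π.symm e).2; omega)]
  simp [chainLevel]

/-- A rule that finds, for every `x ∈ 𝒦`, a maximal chain associated with `x`, i.e. an order of the
elements along which the coordinates of `x` decrease (so that the weights are nonnegative).
Ties may be broken in any measurable way. -/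
structure ChainRule (n : ℕ) where
  order : Vec n → Equiv.Perm (Fin n)
  antitone : ∀ x ∈ cube n, Antitone fun j => x (order x j)
  measurable : ∀ π, MeasurableSet {x | order x = π}

/-! ### Sampling of the set and one-point estimation of the subgradient -/

/-- `ρ i = (1 - γ) μ i + γ / (n + 1)`. -/
def sampleProb {n : ℕ} (γ : ℝ) (π : Equiv.Perm (Fin n)) (x : Vec n) (i : ℕ) : ℝ :=
  (1 - γ) * chainWeight π x i + γ / (n + 1)

/-- The standard basis vector of the element at (0-based) position `j` of the chain. -/
def chainBasis {n : ℕ} (π : Equiv.Perm (Fin n)) (j : ℕ) : Vec n :=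
  if h : j < n then EuclideanSpace.single (π ⟨j, h⟩) (1 : ℝ) else 0

/-- The estimate `ĝ` when the set `B i`, played with probability `ρ`, had observed cost `y`;
`ξ` is the random sign (`true` for `+1`). -/
def gradEstimate {n : ℕ} (π : Equiv.Perm (Fin n)) (ρ : ℝ) (i : ℕ) (ξ : Bool) (y : ℝ) : Vec n :=
  if i = 0 then (-(1 / ρ * y)) • chainBasis π 0
  else if i = n then (1 / ρ * y) • chainBasis π (n - 1)
  else if ξ then (2 / ρ * y) • chainBasis π (i - 1)
  else (-(2 / ρ * y)) • chainBasis π i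

/-! ### Tree-based aggregation

The complete binary tree has levels `0` (leaves), …, `m = ⌈log₂ T⌉` (root); node `k` of level `j` has
the children `2k` (left) and `2k + 1` (right) on the level below. In round `s` (counted from `0`) the
vector is inserted at leaf `s`, whose path to the root consists of the nodes `s / 2 ^ j`. -/

abbrev Tree (n m : ℕ) : Type := Fin (m + 1) → ℕ → Vec n

/-- Add `z` on the path from leaf `s` to the root, and fresh noise `ζ j` at the path nodes up to and
including the first left child (up to the root if there is none). -/
def treeUpdate {n m : ℕ} (s : ℕ) (z : Vec n) (ζ : Fin (m + 1) → Vec n) (A : Tree n m) : Tree n m :=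
  fun j k =>
    if k = s / 2 ^ (j : ℕ) then
      A j k + z + (if ∀ i < (j : ℕ), ¬ Even (s / 2 ^ i) then ζ j else 0)
    else A j k

/-- The noisy partial sum returned in round `s` (counted from `0`), read off the binary digits of
`s + 1`: the path node if it is a left child (or the root), else its left sibling. -/
def treeOutput {n m : ℕ} (s : ℕ) (A : Tree n m) : Vec n :=
  ∑ j : Fin (m + 1),
    if (s + 1).testBit j then
      (if Even (s / 2 ^ (j : ℕ)) then A j (s / 2 ^ (j : ℕ)) else A j (s / 2 ^ (j : ℕ) - 1))
    else 0

/-- The probability measure on `ℝⁿ` with density proportional to `exp (-‖y‖ / b)`. -/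
def noiseLaw (n : ℕ) (b : ℝ) : Measure (Vec n) :=
  ((volume.withDensity fun y : Vec n => ENNReal.ofReal (Real.exp (-(‖y‖ / b)))) Set.univ)⁻¹ •
    volume.withDensity fun y : Vec n => ENNReal.ofReal (Real.exp (-(‖y‖ / b)))

/-! ### The algorithm -/

/-- A minimizer of `Φ` over `K` (an arbitrary vector if there is none). -/
def argminOn {n : ℕ} (K : Set (Vec n)) (Φ : Vec n → ℝ) : Vec n :=
  Classical.epsilon fun x => x ∈ K ∧ ∀ y ∈ K, Φ x ≤ Φ y

/-- Inputs of the algorithm: the horizon `T`, the parameters `H, L, ε, γ`, the initial point and the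
rule by which maximal chains are found in each round. -/
structure Params (n : ℕ) where
  T : ℕ
  H : ℝ
  L : ℝ
  ε : ℝ
  γ : ℝ
  x₁ : Vec n
  chain : ℕ → ChainRule n

/-- The depth `⌈log₂ T⌉` of the tree. -/
def Params.depth {n : ℕ} (P : Params n) : ℕ := Nat.clog 2 P.T

/-- Random draws of one round: the index of the chain set that is played, the sign `ξ`, and the noise
vectors for the levels of the tree. -/
abbrev Draw {n : ℕ} (P : Params n) : Type :=
  Fin (n + 1) × Bool × (Fin (P.depth + 1) → Vec n)

/-- Memory of the algorithm: the iterates computed so far and the tree. -/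
structure State {n : ℕ} (P : Params n) where
  iter : ℕ → Vec n
  tree : Tree n P.depth

/-- The order of the maximal chain used in round `s` (counted from `0`). -/
def State.order {n : ℕ} {P : Params n} (σ : State P) (s : ℕ) : Equiv.Perm (Fin n) :=
  (P.chain s).order (σ.iter s)

/-- The law of the draws of round `s` in state `σ`: independent, the index `i` has probability `ρ i`,
the sign is uniform, and the noise vectors have density `∝ exp (-‖y‖ ε / (L (⌈log₂ T⌉ + 1)))`. -/
def roundLaw {n : ℕ} {P : Params n} (s : ℕ) (σ : State P) : Measure (Draw P) :=
  (∑ i : Fin (n + 1),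
      ENNReal.ofReal (sampleProb P.γ (σ.order s) (σ.iter s) i) • Measure.dirac i).prod
    ((PMF.uniformOfFintype Bool).toMeasure.prod
      (Measure.pi fun _ => noiseLaw n (P.L * (P.depth + 1) / P.ε)))

/-- The set played in round `s`. -/
def playedSet {n : ℕ} {P : Params n} (s : ℕ) (σ : State P) (d : Draw P) : Finset (Fin n) :=
  chainSet (σ.order s) d.1

/-- Update of the memory at the end of round `s`, in which only the cost `y` of the played set has been
observed: form `ĝ`, pass `ĝ + H x` to the tree, and minimize over the cube. -/
def nextState {n : ℕ} {P : Params n} (s : ℕ) (σ : State P) (d : Draw P) (y : ℝ) : State P :=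
  let π := σ.order s
  let x := σ.iter s
  let g := gradEstimate π (sampleProb P.γ π x d.1) d.1 d.2.1 y
  let A := treeUpdate s (g + P.H • x) d.2.2 σ.tree
  let v := treeOutput s A
  { iter := Function.update σ.iter (s + 1)
      (argminOn (cube n) fun w =>
        inner ℝ v w + P.H / 2 * ∑ τ ∈ Finset.range (s + 1), ‖w - σ.iter τ‖ ^ 2)
    tree := A }

/-- The memory after `s` rounds against the costs `f 0, f 1, …`, as a function of the draws `ω`. -/
def stateAt {n : ℕ} (P : Params n) (f : ℕ → Finset (Fin n) → ℝ) (ω : ℕ → Draw P) : ℕ → State P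
  | 0 => { iter := fun _ => P.x₁, tree := 0 }
  | s + 1 =>
    let σ := stateAt P f ω s
    nextState s σ (ω s) (f s (playedSet s σ (ω s)))

/-- The joint law of the draws of the first `t` rounds (later draws are set to a dummy value): in each
round the draws are sampled from `roundLaw` in the current state. -/
def runLaw {n : ℕ} (P : Params n) (f : ℕ → Finset (Fin n) → ℝ) : ℕ → Measure (ℕ → Draw P)
  | 0 => Measure.dirac fun _ => (0, true, 0)
  | t + 1 => (runLaw P f t).bind fun ω =>
      (roundLaw t (stateAt P f ω t)).map fun d => Function.update ω t d

/-- Total cost of the sets played in the `T` rounds minus the cost of the best fixed set. -/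
def regret {n : ℕ} (P : Params n) (f : ℕ → Finset (Fin n) → ℝ) (ω : ℕ → Draw P) : ℝ :=
  (∑ t ∈ Finset.range P.T, f t (playedSet t (stateAt P f ω t) (ω t))) -
    Finset.univ.inf' Finset.univ_nonempty
      fun S : Finset (Fin n) => ∑ t ∈ Finset.range P.T, f t S

end BanditSubmodular

end

open BanditSubmodular

/-! The regret splits into exploration, linear optimization and noise.

Fix a set `S` that minimizes the total cost. Given the past, the estimate of round `t` satisfies `E
⟪ĝ, w⟫ = ∑ i, μ i(w) f(B i) - f(∅)`, where `μ i(w)` are the weights of `w` along the current chain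
(`sampleProb_mul_inner_gradEstimate`). At `w = x_t` the sum is the mean cost without exploration; at
`w = 𝒳_S` submodularity bounds it by `f(S)` (`sum_chainWeight_charVec_le`). Hence the mean regret of
a round is at most the mean of `⟪ĝ, x_t - 𝒳_S⟫` plus an exploration cost `2γM`
(`integral_runCost_sub_le`).

The linear part is bounded for every outcome. The terms `H x_τ` in the tree cancel the linear parts
of `H/2 ‖x - x_τ‖²`, and the binary digits of `t` select nodes that tile the first `t` leaves. So
`x_{t+1}` minimizes `⟪∑ ĝ + noise, x⟫ + H t / 2 ‖x‖²` over the cube (`runIter_succ`). Without noise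
this is follow-the-regularized-leader, with regret of order `G² log T / H + H T n` when `‖ĝ‖ ≤ G`
(`ftrl_regret_le`). The noise moves the iterate by at most `‖noise‖ / (H t)`, which costs `G ‖noise‖
/ (H t)` (`norm_runIter_sub_ftrl_le`). Since `G` is a sure bound, only the mean norm of each single
noise vector is needed, namely `n` times its scale (`integral_norm_noiseLaw`); no independence of
noise and gradients enters.

Exploration makes every set have probability at least `γ / (n + 1)`, so `G` can be taken as `4 M
T^(1/4)`. With `H` of order `M / (√n T^(1/4))` all terms are within the stated rate (`rate_bound`).
-/

namespace BanditSubmodular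

/-! ### Regularized linear minimization over the cube -/

/-- The minimizer of `⟪v, x⟫ + a / 2 * ‖x‖ ^ 2` over the cube. -/
noncomputable def cubeProj {n : ℕ} (v : Vec n) (a : ℝ) : Vec n :=
  WithLp.toLp 2 fun i => max 0 (min 1 (-(v i) / a))

theorem cubeProj_apply {n : ℕ} (v : Vec n) (a : ℝ) (i : Fin n) :
    cubeProj v a i = max 0 (min 1 (-(v i) / a)) := rfl

theorem cubeProj_mem_cube {n : ℕ} (v : Vec n) (a : ℝ) : cubeProj v a ∈ cube n := by
  intro i
  rw [cubeProj_apply]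
  exact ⟨le_max_left _ _, max_le zero_le_one (min_le_left _ _)⟩

theorem inner_eq_sum {n : ℕ} (x y : Vec n) : inner ℝ x y = ∑ i, x i * y i := by
  simp [PiLp.inner_apply, mul_comm]

theorem norm_le_sqrt_of_mem_cube {n : ℕ} {x : Vec n} (hx : x ∈ cube n) : ‖x‖ ≤ √n := by
  rw [EuclideanSpace.norm_eq]
  apply Real.sqrt_le_sqrt
  calc ∑ i, ‖x i‖ ^ 2 ≤ ∑ _i : Fin n, (1 : ℝ) := by
        refine Finset.sum_le_sum fun i _ => ?_
        have h := hx i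
        rw [Real.norm_eq_abs, sq_abs]
        nlinarith [h.1, h.2]
    _ = n := by simp

/-- The first-order optimality condition `0 ≤ (v + a c)(y - c)` at the clamped point `c`, added to
the exact expansion of the quadratic about `c`, gives the growth term. -/
theorem clamp_growth (v a y : ℝ) (ha : 0 < a) (hy : y ∈ Set.Icc (0 : ℝ) 1) :
    v * max 0 (min 1 (-v / a)) + a / 2 * (max 0 (min 1 (-v / a))) ^ 2
        + a / 2 * (y - max 0 (min 1 (-v / a))) ^ 2 ≤ v * y + a / 2 * y ^ 2 := by
  set c := max 0 (min 1 (-v / a)) with hc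
  have key : 0 ≤ (v + a * c) * (y - c) := by
    rcases le_total (-v / a) 0 with h | h
    · have hc0 : c = 0 := by rw [hc]; exact max_eq_left ((min_le_right _ _).trans h)
      rw [div_nonpos_iff] at h
      rw [hc0]
      rcases h with h | h <;> nlinarith [hy.1, h.1, h.2]
    rcases le_total (-v / a) 1 with h1 | h1
    · have hc0 : c = -v / a := by rw [hc, min_eq_right h1, max_eq_right h]
      have : v + a * c = 0 := by rw [hc0]; field_simp; ring
      rw [this, zero_mul]
    · have hc0 : c = 1 := by rw [hc, min_eq_left h1]; simp
      rw [le_div_iff₀ ha] at h1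
      rw [hc0]
      nlinarith [hy.2]
  nlinarith

/-- The minimizer over the cube, with quadratic growth away from it. -/
theorem cubeProj_growth {n : ℕ} (v : Vec n) {a : ℝ} (ha : 0 < a) {y : Vec n} (hy : y ∈ cube n) :
    inner ℝ v (cubeProj v a) + a / 2 * ‖cubeProj v a‖ ^ 2 + a / 2 * ‖y - cubeProj v a‖ ^ 2
      ≤ inner ℝ v y + a / 2 * ‖y‖ ^ 2 := by
  simp only [inner_eq_sum, EuclideanSpace.real_norm_sq_eq, Finset.mul_sum, ← Finset.sum_add_distrib]
  exact Finset.sum_le_sum fun i _ => clamp_growth (v i) a (y i) ha (hy i)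

/-- Clamping a coordinate is 1-Lipschitz. This is the stability estimate that converts noise in the
aggregate into displacement of the iterate. -/
theorem norm_cubeProj_sub_le {n : ℕ} (v w : Vec n) {a : ℝ} (ha : 0 < a) :
    ‖cubeProj v a - cubeProj w a‖ ≤ ‖v - w‖ / a := by
  have h : ‖v - w‖ / a = ‖a⁻¹ • (v - w)‖ := by
    rw [norm_smul, Real.norm_eq_abs, abs_of_pos (inv_pos.2 ha)]; field_simp
  rw [h, EuclideanSpace.norm_eq, EuclideanSpace.norm_eq]
  refine Real.sqrt_le_sqrt (Finset.sum_le_sum fun i _ => ?_)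
  refine pow_le_pow_left₀ (norm_nonneg _) ?_ 2
  simp only [PiLp.sub_apply, cubeProj_apply, Real.norm_eq_abs, PiLp.smul_apply, smul_eq_mul]
  calc |max 0 (min 1 (-(v i) / a)) - max 0 (min 1 (-(w i) / a))|
      ≤ |min 1 (-(v i) / a) - min 1 (-(w i) / a)| := by
        have := abs_max_sub_max_le_abs (min 1 (-(v i) / a)) (min 1 (-(w i) / a)) 0
        simpa only [max_comm] using this
    _ ≤ |-(v i) / a - -(w i) / a| := by
        have := abs_inf_sub_inf_le_abs (-(v i) / a) (-(w i) / a) 1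
        simpa [min_comm] using this
    _ = |a⁻¹ * (v i - w i)| := by
        rw [← abs_neg]; congr 1; field_simp; ring

/-- The regularized leader is the clamped point. -/
theorem argminOn_cube_eq {n : ℕ} (v : Vec n) {H : ℝ} (hH : 0 < H) (s : ℕ) (x : ℕ → Vec n) :
    argminOn (cube n) (fun w => inner ℝ v w + H / 2 * ∑ τ ∈ Finset.range (s + 1), ‖w - x τ‖ ^ 2)
      = cubeProj (v - H • ∑ τ ∈ Finset.range (s + 1), x τ) (H * (s + 1)) := by
  set a : ℝ := H * (s + 1) with ha
  set v' := v - H • ∑ τ ∈ Finset.range (s + 1), x τ with hv'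
  have ha0 : 0 < a := by positivity
  -- The `s + 1` quadratics merge into one centred at the origin; their linear parts are absorbed
  -- into `v'`.
  have hΦ : ∀ w : Vec n, inner ℝ v w + H / 2 * ∑ τ ∈ Finset.range (s + 1), ‖w - x τ‖ ^ 2
      = inner ℝ v' w + a / 2 * ‖w‖ ^ 2 + H / 2 * ∑ τ ∈ Finset.range (s + 1), ‖x τ‖ ^ 2 := by
    intro w
    simp only [norm_sub_sq_real, Finset.sum_add_distrib, Finset.sum_sub_distrib, Finset.sum_const,
      Finset.card_range, nsmul_eq_mul, hv', inner_sub_left, inner_smul_left, sum_inner,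
      ← Finset.mul_sum, ha]
    have : ∑ τ ∈ Finset.range (s + 1), inner ℝ w (x τ) = ∑ τ ∈ Finset.range (s + 1), inner ℝ (x τ) w :=
      Finset.sum_congr rfl fun τ _ => real_inner_comm _ _
    rw [this]
    push_cast
    simp
    ring
  have hmin : ∀ y ∈ cube n, inner ℝ v' (cubeProj v' a) + a / 2 * ‖cubeProj v' a‖ ^ 2
      + a / 2 * ‖y - cubeProj v' a‖ ^ 2 ≤ inner ℝ v' y + a / 2 * ‖y‖ ^ 2 :=
    fun y hy => cubeProj_growth v' ha0 hy
  have hex : ∃ x₀, x₀ ∈ cube n ∧ ∀ y ∈ cube n,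
      inner ℝ v x₀ + H / 2 * ∑ τ ∈ Finset.range (s + 1), ‖x₀ - x τ‖ ^ 2
        ≤ inner ℝ v y + H / 2 * ∑ τ ∈ Finset.range (s + 1), ‖y - x τ‖ ^ 2 := by
    refine ⟨cubeProj v' a, cubeProj_mem_cube _ _, fun y hy => ?_⟩
    rw [hΦ, hΦ]
    have := hmin y hy
    have h2 : 0 ≤ a / 2 * ‖y - cubeProj v' a‖ ^ 2 := by positivity
    linarith
  obtain ⟨h1, h2⟩ := Classical.epsilon_spec hex
  change argminOn (cube n) _ ∈ _ at h1
  have h3 := h2 _ (cubeProj_mem_cube v' a)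
  change inner ℝ v (argminOn (cube n) _) + _ * ∑ τ ∈ _, ‖argminOn (cube n) _ - _‖ ^ 2 ≤ _ at h3
  rw [hΦ, hΦ] at h3
  -- `argminOn` only selects some minimizer; quadratic growth about the clamped point leaves no
  -- other candidate.
  have h4 := hmin _ h1
  have h5 : a / 2 * ‖argminOn (cube n) (fun w => inner ℝ v w + H / 2 *
      ∑ τ ∈ Finset.range (s + 1), ‖w - x τ‖ ^ 2) - cubeProj v' a‖ ^ 2 ≤ 0 := by linarith
  have h6 : ‖argminOn (cube n) (fun w => inner ℝ v w + H / 2 *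
      ∑ τ ∈ Finset.range (s + 1), ‖w - x τ‖ ^ 2) - cubeProj v' a‖ ^ 2 ≤ 0 := by
    by_contra hcon
    push Not at hcon
    have : 0 < a / 2 := by positivity
    nlinarith
  have h7 := le_antisymm h6 (sq_nonneg _)
  exact sub_eq_zero.1 (norm_eq_zero.1 (pow_eq_zero_iff (two_ne_zero) |>.1 h7))

/-! ### Follow the regularized leader -/

/-- The iterates of follow-the-regularized-leader with linear costs `g` and regularization `H`. -/
noncomputable def ftrl {n : ℕ} (x₀ : Vec n) (H : ℝ) (g : ℕ → Vec n) : ℕ → Vec n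
  | 0 => x₀
  | t + 1 => cubeProj (∑ τ ∈ Finset.range (t + 1), g τ) (H * (t + 1))

theorem ftrl_mem_cube {n : ℕ} {x₀ : Vec n} (hx₀ : x₀ ∈ cube n) (H : ℝ) (g : ℕ → Vec n) (t : ℕ) :
    ftrl x₀ H g t ∈ cube n := by
  cases t with
  | zero => exact hx₀
  | succ t => exact cubeProj_mem_cube _ _

/-- At `t = 0` the objective and the growth term vanish, so an arbitrary starting point is allowed.
-/
theorem ftrl_growth {n : ℕ} (x₀ : Vec n) {H : ℝ} (hH : 0 < H) (g : ℕ → Vec n) (t : ℕ)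
    {y : Vec n} (hy : y ∈ cube n) :
    inner ℝ (∑ τ ∈ Finset.range t, g τ) (ftrl x₀ H g t) + H * t / 2 * ‖ftrl x₀ H g t‖ ^ 2
        + H * t / 2 * ‖y - ftrl x₀ H g t‖ ^ 2
      ≤ inner ℝ (∑ τ ∈ Finset.range t, g τ) y + H * t / 2 * ‖y‖ ^ 2 := by
  cases t with
  | zero => simp
  | succ t =>
    have ha : 0 < H * ((t : ℝ) + 1) := by positivity
    have := cubeProj_growth (∑ τ ∈ Finset.range (t + 1), g τ) ha hy
    simpa [ftrl] using this

/-- Induction on the minimum of the accumulated regularized cost: a new round fails to raise it by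
the full cost of the current leader only by the amount that can be gained in moving to the next
leader. -/
theorem sum_ftrl_le {n : ℕ} {x₀ : Vec n} (hx₀ : x₀ ∈ cube n) {H : ℝ} (hH : 0 < H)
    (g : ℕ → Vec n) (T : ℕ) :
    ∑ t ∈ Finset.range T, (inner ℝ (g t) (ftrl x₀ H g t) + H / 2 * ‖ftrl x₀ H g t‖ ^ 2)
      ≤ inner ℝ (∑ τ ∈ Finset.range T, g τ) (ftrl x₀ H g T) + H * T / 2 * ‖ftrl x₀ H g T‖ ^ 2
        + ∑ t ∈ Finset.range T, ‖g t + H • ftrl x₀ H g t‖ ^ 2 / (2 * H * (t + 1)) := by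
  induction T with
  | zero => simp
  | succ T ih =>
    rw [Finset.sum_range_succ, Finset.sum_range_succ (fun t => ‖g t + H • ftrl x₀ H g t‖ ^ 2 / _),
      Finset.sum_range_succ g]
    set x := ftrl x₀ H g T with hx
    set y := ftrl x₀ H g (T + 1) with hy
    set G := ∑ τ ∈ Finset.range T, g τ with hG
    have h1 := ftrl_growth x₀ hH g T (ftrl_mem_cube hx₀ H g (T + 1))
    rw [← hx, ← hy, ← hG] at h1
    have ha : 0 < H * ((T : ℝ) + 1) := by positivity
    set a := H * ((T : ℝ) + 1) with hadef
    -- Completing the square. The curvature `a = H (T + 1)` is `H T` from the growth in `h1` plus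
    -- `H` from the regularizer of the new round, whose cost has gradient `g T + H x` at `x`.
    have h2 : - (‖g T + H • x‖ ^ 2 / (2 * a)) ≤
        inner ℝ (g T + H • x) (y - x) + a / 2 * ‖y - x‖ ^ 2 := by
      have hc := abs_real_inner_le_norm (g T + H • x) (y - x)
      have hc' := neg_le_of_abs_le hc
      have hsq : 0 ≤ (‖g T + H • x‖ - a * ‖y - x‖) ^ 2 / (2 * a) := by positivity
      have e : (‖g T + H • x‖ - a * ‖y - x‖) ^ 2 / (2 * a) =
        ‖g T + H • x‖ ^ 2 / (2 * a) - ‖g T + H • x‖ * ‖y - x‖ + a / 2 * ‖y - x‖ ^ 2 := by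
        field_simp
        ring
      linarith
    have h3 : ‖y‖ ^ 2 = ‖x‖ ^ 2 + 2 * inner ℝ x (y - x) + ‖y - x‖ ^ 2 := by
      have := norm_add_sq_real x (y - x)
      rwa [add_sub_cancel] at this
    have e1 : 2 * H * ((T : ℝ) + 1) = 2 * a := by rw [hadef]; ring
    rw [e1]
    simp only [inner_add_left, inner_sub_right, inner_smul_left, conj_trivial] at h2 h3 ⊢
    push_cast
    rw [hadef] at h2
    rw [hadef]
    nlinarith

/-- The regret of follow-the-regularized-leader against a point of the cube. -/
theorem ftrl_regret_le {n : ℕ} {x₀ u : Vec n} (hx₀ : x₀ ∈ cube n) (hu : u ∈ cube n) {H : ℝ}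
    (hH : 0 < H) (g : ℕ → Vec n) (T : ℕ) :
    ∑ t ∈ Finset.range T, inner ℝ (g t) (ftrl x₀ H g t - u)
      ≤ ∑ t ∈ Finset.range T, ‖g t + H • ftrl x₀ H g t‖ ^ 2 / (2 * H * (t + 1)) + H * T / 2 * n := by
  have h1 := sum_ftrl_le hx₀ hH g T
  have h2 := ftrl_growth x₀ hH g T hu
  have h3 : 0 ≤ H * T / 2 * ‖u - ftrl x₀ H g T‖ ^ 2 := by positivity
  have h4 : ‖u‖ ^ 2 ≤ n := by
    have := pow_le_pow_left₀ (norm_nonneg _) (norm_le_sqrt_of_mem_cube hu) 2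
    rwa [Real.sq_sqrt (Nat.cast_nonneg n)] at this
  have h5 : H * T / 2 * ‖u‖ ^ 2 ≤ H * T / 2 * n := by gcongr
  have h6 : 0 ≤ ∑ t ∈ Finset.range T, H / 2 * ‖ftrl x₀ H g t‖ ^ 2 :=
    Finset.sum_nonneg fun t _ => by positivity
  rw [sum_inner] at h2
  simp only [inner_sub_right, Finset.sum_sub_distrib, Finset.sum_add_distrib, sum_inner] at *
  linarith

/-! ### Chains and one-point gradient estimates -/

theorem chainLevel_mem_Icc {n : ℕ} (π : Equiv.Perm (Fin n)) {x : Vec n} (hx : x ∈ cube n) (i : ℕ) :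
    chainLevel π x i ∈ Set.Icc (0 : ℝ) 1 := by
  cases i with
  | zero => simp [chainLevel]
  | succ j =>
    by_cases h : j < n
    · simpa [chainLevel, h] using hx (π ⟨j, h⟩)
    · simp [chainLevel, h]

theorem chainWeight_nonneg {n : ℕ} {π : Equiv.Perm (Fin n)} {x : Vec n} (hx : x ∈ cube n)
    (hπ : Antitone fun j => x (π j)) (i : ℕ) : 0 ≤ chainWeight π x i := by
  unfold chainWeight
  rw [sub_nonneg]
  cases i with
  | zero => exact (chainLevel_mem_Icc π hx 1).2
  | succ j =>
    by_cases h : j + 1 < n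
    · have hj : j < n := by omega
      simp only [chainLevel, h, hj, dif_pos]
      exact hπ (by simp)
    · have : chainLevel π x (j + 1 + 1) = 0 := by simp [chainLevel, h]
      rw [this]
      exact (chainLevel_mem_Icc π hx _).1

theorem sum_sampleProb {n : ℕ} (γ : ℝ) (π : Equiv.Perm (Fin n)) (x : Vec n) :
    ∑ i : Fin (n + 1), sampleProb γ π x i = 1 := by
  have h : ∑ i : Fin (n + 1), chainWeight π x i = 1 := by
    rw [← sum_chainWeight π x, Finset.sum_range]
  simp only [sampleProb, Finset.sum_add_distrib, ← Finset.mul_sum, h, Finset.sum_const,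
    Finset.card_univ, Fintype.card_fin, nsmul_eq_mul]
  push_cast
  field_simp
  ring

/-- The floor provided by uniform exploration keeps the importance weights `1 / ρ` bounded. -/
theorem le_sampleProb {n : ℕ} {γ : ℝ} (hγ1 : γ ≤ 1) {π : Equiv.Perm (Fin n)} {x : Vec n}
    (hx : x ∈ cube n) (hπ : Antitone fun j => x (π j)) (i : ℕ) :
    γ / (n + 1) ≤ sampleProb γ π x i := by
  unfold sampleProb
  have := mul_nonneg (sub_nonneg.2 hγ1) (chainWeight_nonneg hx hπ i)
  linarith

theorem norm_chainBasis_le {n : ℕ} (π : Equiv.Perm (Fin n)) (j : ℕ) : ‖chainBasis π j‖ ≤ 1 := by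
  unfold chainBasis
  split_ifs <;> simp

theorem norm_gradEstimate_le {n : ℕ} (π : Equiv.Perm (Fin n)) {ρ : ℝ} (hρ : 0 < ρ) (i : ℕ)
    (ξ : Bool) (y : ℝ) : ‖gradEstimate π ρ i ξ y‖ ≤ 2 / ρ * |y| := by
  have h12 : 1 / ρ * |y| ≤ 2 / ρ * |y| := by gcongr; norm_num
  have key : ∀ (c : ℝ) (j : ℕ), |c| ≤ 2 / ρ * |y| → ‖c • chainBasis π j‖ ≤ 2 / ρ * |y| := by
    intro c j hc
    rw [norm_smul, Real.norm_eq_abs]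
    exact (mul_le_of_le_one_right (abs_nonneg c) (norm_chainBasis_le π j)).trans hc
  unfold gradEstimate
  split_ifs <;> apply key <;>
    simp only [abs_neg, abs_mul, abs_of_pos (one_div_pos.2 hρ), abs_of_pos (div_pos two_pos hρ)]
  · exact h12
  · exact h12
  · exact le_rfl
  · exact le_rfl

theorem inner_chainBasis {n : ℕ} (π : Equiv.Perm (Fin n)) (j : ℕ) (w : Vec n) :
    inner ℝ (chainBasis π j) w = chainLevel π w (j + 1) := by
  by_cases h : j < n <;> simp [chainBasis, chainLevel, h, EuclideanSpace.inner_single_left]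

/-- The contribution of the index `i` to the mean of the estimate. -/
theorem sampleProb_mul_inner_gradEstimate {n : ℕ} (π : Equiv.Perm (Fin n)) {ρ : ℝ}
    (hρ : ρ ≠ 0) (i : ℕ) (y : ℝ) (w : Vec n) :
    ρ * ((inner ℝ (gradEstimate π ρ i true y) w + inner ℝ (gradEstimate π ρ i false y) w) / 2)
      = chainWeight π w i * y - if i = 0 then y else 0 := by
  unfold gradEstimate chainWeight
  rcases Nat.eq_zero_or_pos i with rfl | h0
  · simp only [if_true, inner_smul_left, inner_chainBasis, conj_trivial]
    -- Level `0` is the constant `1` and not a coordinate of `w`, so the estimate misses it; this is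
    -- the origin of the correction `y`, which does not depend on `w`.
    have : chainLevel π w 0 = 1 := rfl
    rw [this]
    field_simp
    ring
  · have h0' : i ≠ 0 := by omega
    rcases eq_or_ne i n with rfl | h1
    · simp only [h0', if_true, if_false, inner_smul_left, inner_chainBasis, conj_trivial]
      have : chainLevel π w (i + 1) = 0 := by simp [chainLevel]
      rw [this, Nat.sub_add_cancel h0]
      field_simp
      ring
    · simp only [h0', h1, if_true, if_false, inner_smul_left, inner_chainBasis, conj_trivial,
        Nat.sub_add_cancel h0, Bool.false_eq_true]
      field_simp
      ring

/-- The characteristic vector of a set. -/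
noncomputable def charVec {n : ℕ} (S : Finset (Fin n)) : Vec n :=
  WithLp.toLp 2 fun i => if i ∈ S then 1 else 0

theorem charVec_mem_cube {n : ℕ} (S : Finset (Fin n)) : charVec S ∈ cube n := by
  intro i
  change (if i ∈ S then (1 : ℝ) else 0) ∈ _
  split_ifs <;> simp

theorem chainSet_zero {n : ℕ} (π : Equiv.Perm (Fin n)) : chainSet π 0 = ∅ := by
  simp [chainSet]

theorem chainSet_self {n : ℕ} (π : Equiv.Perm (Fin n)) : chainSet π n = Finset.univ := by
  simp [chainSet]

theorem chainSet_succ {n : ℕ} (π : Equiv.Perm (Fin n)) {i : ℕ} (hi : i < n) :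
    chainSet π (i + 1) = insert (π ⟨i, hi⟩) (chainSet π i) := by
  ext e
  simp only [chainSet, Finset.mem_filter, Finset.mem_univ, true_and, Finset.mem_insert]
  rw [Nat.lt_succ_iff_lt_or_eq, or_comm, ← Equiv.symm_apply_eq, Fin.ext_iff]

/-- Along every chain, the linearization of a submodular function underestimates it. -/
theorem sum_chainWeight_charVec_le {n : ℕ} {f : Finset (Fin n) → ℝ} (hf : IsSubmodular f)
    (π : Equiv.Perm (Fin n)) (S : Finset (Fin n)) :
    ∑ i : Fin (n + 1), chainWeight π (charVec S) i * f (chainSet π i) ≤ f S := by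
  -- By summation by parts the left side is `f(∅)` plus the marginals of `f` along the chain at the
  -- elements of `S`. Each marginal over `B j` is at most the one over `S ∩ B j`, and the latter
  -- telescope. The chain need not be sorted for `S`, so negative weights are allowed.
  have key : ∀ i ≤ n, ∑ j ∈ Finset.range i, chainWeight π (charVec S) j * f (chainSet π j)
      + chainLevel π (charVec S) i * f (chainSet π i) ≤ f (S ∩ chainSet π i) := by
    intro i
    induction i with
    | zero => simp [chainLevel, chainSet_zero]
    | succ i ih =>
      intro hi
      have hi' : i < n := hi
      have h1 := ih hi'.le
      rw [Finset.sum_range_succ]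
      have h2 : chainLevel π (charVec S) (i + 1) = if π ⟨i, hi'⟩ ∈ S then 1 else 0 := by
        simp [chainLevel, hi', charVec]
      have hnot : π ⟨i, hi'⟩ ∉ chainSet π i := by simp [chainSet]
      unfold chainWeight at *
      by_cases hS : π ⟨i, hi'⟩ ∈ S
      · rw [if_pos hS] at h2
        have h3 := hf (S ∩ chainSet π i) (chainSet π i) Finset.inter_subset_right _ hnot
        rw [chainSet_succ π hi', Finset.inter_insert_of_mem hS, h2] at *
        linarith
      · rw [if_neg hS] at h2
        rw [chainSet_succ π hi', Finset.inter_insert_of_notMem hS, h2]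
        linarith
  have h := key n le_rfl
  rw [chainSet_self, Finset.inter_univ] at h
  rw [← Finset.sum_range fun i => chainWeight π (charVec S) i * f (chainSet π i),
    Finset.sum_range_succ]
  have h0 : chainLevel π (charVec S) (n + 1) = 0 := by simp [chainLevel]
  unfold chainWeight at *
  rw [h0, sub_zero, chainSet_self]
  exact h

/-- In the mean over the played set and the sign, the regret of one round is at most that of the
estimated linear cost, up to the exploration error. -/
theorem sum_sampleProb_regret_le {n : ℕ} {γ M : ℝ} (hγ0 : 0 < γ) (hγ1 : γ ≤ 1)
    {f : Finset (Fin n) → ℝ} (hf : IsSubmodular f) (hM : ∀ S, f S ∈ Set.Icc (-M) M)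
    {π : Equiv.Perm (Fin n)} {x : Vec n} (hx : x ∈ cube n) (hπ : Antitone fun j => x (π j))
    (S : Finset (Fin n)) :
    ∑ i : Fin (n + 1), sampleProb γ π x i * (f (chainSet π i) - f S -
      (inner ℝ (gradEstimate π (sampleProb γ π x i) i true (f (chainSet π i))) (x - charVec S) +
       inner ℝ (gradEstimate π (sampleProb γ π x i) i false (f (chainSet π i))) (x - charVec S)) / 2)
      ≤ 2 * γ * M := by
  have hρ : ∀ i : ℕ, sampleProb γ π x i ≠ 0 := fun i =>
    ((show 0 < γ / (n + 1) by positivity).trans_le (le_sampleProb hγ1 hx hπ i)).ne'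
  have h1 : ∀ i : Fin (n + 1), sampleProb γ π x i * (f (chainSet π i) - f S -
      (inner ℝ (gradEstimate π (sampleProb γ π x i) i true (f (chainSet π i))) (x - charVec S) +
       inner ℝ (gradEstimate π (sampleProb γ π x i) i false (f (chainSet π i))) (x - charVec S)) / 2)
      = chainWeight π (charVec S) i * f (chainSet π i)
        + γ * ((1 / (n + 1) - chainWeight π x i) * f (chainSet π i))
        - sampleProb γ π x i * f S := by
    intro i
    have hx' := sampleProb_mul_inner_gradEstimate π (hρ i) i (f (chainSet π i)) x
    have hu' := sampleProb_mul_inner_gradEstimate π (hρ i) i (f (chainSet π i)) (charVec S)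
    have hs : sampleProb γ π x i = (1 - γ) * chainWeight π x i + γ * (1 / (n + 1)) := by
      rw [sampleProb]; ring
    simp only [inner_sub_right]
    -- The correction at `i = 0` is the same for `x` and `charVec S` and cancels.
    linear_combination hu' - hx' + f (chainSet π i) * hs
  simp only [h1, Finset.sum_sub_distrib, Finset.sum_add_distrib, ← Finset.sum_mul, sum_sampleProb,
    ← Finset.mul_sum]
  have h2 := sum_chainWeight_charVec_le hf π S
  -- The uniform law and `μ` are two probability vectors, so their difference has absolute mass at
  -- most `2`.
  have h3 : ∑ i : Fin (n + 1), (1 / ((n : ℝ) + 1) - chainWeight π x i) * f (chainSet π i)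
      ≤ 2 * M := by
    have hw : ∑ i : Fin (n + 1), chainWeight π x i = 1 := by
      rw [← sum_chainWeight π x, Finset.sum_range]
    calc ∑ i : Fin (n + 1), (1 / ((n : ℝ) + 1) - chainWeight π x i) * f (chainSet π i)
        ≤ ∑ i : Fin (n + 1), (1 / ((n : ℝ) + 1) + chainWeight π x i) * M := by
          refine Finset.sum_le_sum fun i _ => ?_
          have hw0 := chainWeight_nonneg hx hπ i
          have hn0 : 0 ≤ 1 / ((n : ℝ) + 1) := by positivity
          nlinarith [(hM (chainSet π i)).1, (hM (chainSet π i)).2]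
      _ = 2 * M := by
          rw [← Finset.sum_mul, Finset.sum_add_distrib, hw]
          simp only [Finset.sum_const, Finset.card_univ, Fintype.card_fin, nsmul_eq_mul]
          push_cast
          field_simp
          ring
  have h4 := mul_le_mul_of_nonneg_left h3 hγ0.le
  linarith

/-! ### Tree-based aggregation -/

/-- Both sides say that the `j` lowest binary digits of `s` are all `1`, that is, leaf `s` is the
last one below its ancestor at level `j`. Thus a node receives noise exactly once, when its block of
leaves is complete. -/
theorem forall_not_even_iff (s j : ℕ) :
    (∀ i < j, ¬ Even (s / 2 ^ i)) ↔ (s / 2 ^ j + 1) * 2 ^ j = s + 1 := by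
  induction j with
  | zero => simp
  | succ j ih =>
    rw [Nat.forall_lt_succ_right, ih, pow_succ, ← Nat.div_div_eq_div_mul]
    have hs : s < (s / 2 ^ j + 1) * 2 ^ j := by
      rw [← Nat.div_lt_iff_lt_mul (by positivity)]; omega
    have hp : 0 < 2 ^ j := by positivity
    generalize s / 2 ^ j = a at *
    rcases Nat.even_or_odd' a with ⟨b, rfl | rfl⟩
    · have h1 : 2 * b / 2 = b := by omega
      rw [h1]
      constructor
      · rintro ⟨-, h⟩; simp at h
      · intro h; nlinarith
    · have h1 : (2 * b + 1) / 2 = b := by omega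
      have h2 : ¬ Even (2 * b + 1) := by simp
      rw [h1]
      constructor
      · rintro ⟨h, -⟩; rw [← h]; ring
      · intro h; exact ⟨by rw [← h]; ring, h2⟩

/-- Contents of the tree: every node holds the sum of the vectors inserted below it, and its noise
once its last leaf has been reached. -/
theorem tree_eq {n m : ℕ} {z : ℕ → Vec n} {ζ : ℕ → Fin (m + 1) → Vec n} {A : ℕ → Tree n m}
    (h0 : A 0 = 0) (hA : ∀ s, A (s + 1) = treeUpdate s (z s) (ζ s) (A s))
    (s : ℕ) (j : Fin (m + 1)) (k : ℕ) :
    A s j k = ∑ τ ∈ (Finset.range s).filter (fun τ => τ / 2 ^ (j : ℕ) = k), z τ +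
      if (k + 1) * 2 ^ (j : ℕ) ≤ s then ζ ((k + 1) * 2 ^ (j : ℕ) - 1) j else 0 := by
  have hp : 0 < 2 ^ (j : ℕ) := by positivity
  induction s with
  | zero => simp [h0]
  | succ s ih =>
    rw [hA]
    unfold treeUpdate
    rw [Finset.range_add_one, Finset.filter_insert]
    by_cases hk : k = s / 2 ^ (j : ℕ)
    · have hlt : ¬ ((k + 1) * 2 ^ (j : ℕ) ≤ s) := by
        rw [not_le, ← Nat.div_lt_iff_lt_mul hp]; omega
      rw [if_pos hk, if_pos hk.symm, Finset.sum_insert (by simp), ih, if_neg hlt, add_zero]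
      simp only [forall_not_even_iff, ← hk]
      have hiff : (k + 1) * 2 ^ (j : ℕ) ≤ s + 1 ↔ (k + 1) * 2 ^ (j : ℕ) = s + 1 := by omega
      simp only [hiff]
      by_cases hc : (k + 1) * 2 ^ (j : ℕ) = s + 1
      · rw [if_pos hc, if_pos hc, hc, Nat.add_sub_cancel]
        abel
      · rw [if_neg hc, if_neg hc]
        abel
    · rw [if_neg hk, if_neg (Ne.symm hk), ih]
      have hne : (k + 1) * 2 ^ (j : ℕ) ≠ s + 1 := by
        intro h
        apply hk
        symm
        exact Nat.div_eq_of_lt_le (by nlinarith) (by omega)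
      have hiff : (k + 1) * 2 ^ (j : ℕ) ≤ s + 1 ↔ (k + 1) * 2 ^ (j : ℕ) ≤ s := by omega
      simp only [hiff]

theorem filter_div_eq {t p k : ℕ} (hp : 0 < p) (h : (k + 1) * p ≤ t) :
    (Finset.range t).filter (fun τ => τ / p = k) = Finset.Ico (k * p) ((k + 1) * p) := by
  ext τ
  simp only [Finset.mem_filter, Finset.mem_range, Finset.mem_Ico]
  constructor
  · rintro ⟨-, rfl⟩
    exact ⟨Nat.div_mul_le_self _ _, Nat.lt_mul_of_div_lt (Nat.lt_succ_self _) hp⟩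
  · rintro ⟨h1, h2⟩
    refine ⟨h2.trans_le h, ?_⟩
    exact Nat.div_eq_of_lt_le h1 h2

/-- The binary expansion of `t` as a tiling: the digits below `J` that equal `1` contribute adjacent
dyadic blocks, from the remainder modulo `2 ^ J` up to `t`. -/
theorem sum_testBit {E : Type*} [AddCommMonoid E] (z : ℕ → E) (t J : ℕ) :
    (∑ j ∈ Finset.range J, if t.testBit j then
      ∑ τ ∈ (Finset.range t).filter (fun τ => τ / 2 ^ j = t / 2 ^ j - 1), z τ else 0)
      = ∑ τ ∈ Finset.Ico (t / 2 ^ J * 2 ^ J) t, z τ := by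
  induction J with
  | zero => simp
  | succ J ih =>
    rw [Finset.sum_range_succ, ih, pow_succ, ← Nat.div_div_eq_div_mul, mul_comm (2 ^ J) 2, ← mul_assoc,
      Nat.testBit_eq_decide_div_mod_eq]
    have hle : t / 2 ^ J * 2 ^ J ≤ t := Nat.div_mul_le_self _ _
    have hp : 0 < 2 ^ J := by positivity
    generalize t / 2 ^ J = a at *
    by_cases h : a % 2 = 1
    · have h1 : a / 2 * 2 = a - 1 := by omega
      have h2 : a - 1 + 1 = a := by omega
      rw [h1, if_pos (by simpa using h), filter_div_eq hp (by rw [h2]; exact hle), h2, add_comm,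
        Finset.sum_Ico_consecutive _ (Nat.mul_le_mul_right _ (Nat.sub_le _ _)) hle]
    · have h1 : a / 2 * 2 = a := by omega
      rw [h1, if_neg (by simpa using h), add_zero]

/-- The aggregate returned in round `s` is the partial sum plus the noise of the nodes read. -/
theorem treeOutput_eq {n m : ℕ} {z : ℕ → Vec n} {ζ : ℕ → Fin (m + 1) → Vec n} {A : ℕ → Tree n m}
    (h0 : A 0 = 0) (hA : ∀ s, A (s + 1) = treeUpdate s (z s) (ζ s) (A s)) {s : ℕ}
    (hs : s + 1 < 2 ^ (m + 1)) :
    treeOutput s (A (s + 1)) = ∑ τ ∈ Finset.range (s + 1), z τ +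
      ∑ j : Fin (m + 1), if (s + 1).testBit j then
        ζ ((s + 1) / 2 ^ (j : ℕ) * 2 ^ (j : ℕ) - 1) j else 0 := by
  have h1 := sum_testBit z (s + 1) (m + 1)
  rw [Nat.div_eq_of_lt hs, zero_mul, Nat.Ico_zero_eq_range, Finset.sum_range] at h1
  rw [← h1, ← Finset.sum_add_distrib]
  unfold treeOutput
  refine Finset.sum_congr rfl fun j _ => ?_
  by_cases hb : (s + 1).testBit j
  swap
  · simp [hb]
  simp only [hb, if_true]
  rw [Nat.testBit_eq_decide_div_mod_eq, decide_eq_true_eq] at hb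
  -- Digit `j` of `s + 1` is set, so `(s + 1) / 2 ^ j` is odd. It equals `s / 2 ^ j` when the path
  -- node is a right child, and exceeds it by one when the path node is a left child just completed;
  -- both branches read the same index.
  have hidx : (if Even (s / 2 ^ (j : ℕ)) then A (s + 1) j (s / 2 ^ (j : ℕ))
      else A (s + 1) j (s / 2 ^ (j : ℕ) - 1)) = A (s + 1) j ((s + 1) / 2 ^ (j : ℕ) - 1) := by
    have hd := Nat.succ_div (a := s) (b := 2 ^ (j : ℕ))
    rw [← apply_ite (A (s + 1) j)]
    congr 1
    simp only [Nat.even_iff]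
    generalize (s + 1) / 2 ^ (j : ℕ) = a at *
    generalize s / 2 ^ (j : ℕ) = b at *
    split_ifs at hd ⊢ <;> omega
  rw [hidx, tree_eq h0 hA]
  have h2 : (s + 1) / 2 ^ (j : ℕ) - 1 + 1 = (s + 1) / 2 ^ (j : ℕ) := by
    generalize (s + 1) / 2 ^ (j : ℕ) = a at *
    omega
  rw [h2, if_pos (Nat.div_mul_le_self _ _)]

/-! ### The run of the algorithm -/

/-- The gradient estimate formed in round `s`. -/
noncomputable def runGrad {n : ℕ} (P : Params n) (f : ℕ → Finset (Fin n) → ℝ) (ω : ℕ → Draw P)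
    (s : ℕ) : Vec n :=
  gradEstimate ((stateAt P f ω s).order s)
    (sampleProb P.γ ((stateAt P f ω s).order s) ((stateAt P f ω s).iter s) (ω s).1) (ω s).1 (ω s).2.1
    (f s (playedSet s (stateAt P f ω s) (ω s)))

/-- The iterate used in round `s`. -/
noncomputable def runIter {n : ℕ} (P : Params n) (f : ℕ → Finset (Fin n) → ℝ) (ω : ℕ → Draw P)
    (s : ℕ) : Vec n :=
  (stateAt P f ω s).iter s

theorem tree_stateAt_succ {n : ℕ} (P : Params n) (f : ℕ → Finset (Fin n) → ℝ) (ω : ℕ → Draw P)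
    (s : ℕ) : (stateAt P f ω (s + 1)).tree =
      treeUpdate s (runGrad P f ω s + P.H • runIter P f ω s) (ω s).2.2 (stateAt P f ω s).tree := rfl

theorem iter_stateAt_succ {n : ℕ} (P : Params n) (f : ℕ → Finset (Fin n) → ℝ) (ω : ℕ → Draw P)
    (hH : 0 < P.H) (s : ℕ) : (stateAt P f ω (s + 1)).iter =
      Function.update (stateAt P f ω s).iter (s + 1)
        (cubeProj (treeOutput s (stateAt P f ω (s + 1)).tree -
          P.H • ∑ τ ∈ Finset.range (s + 1), (stateAt P f ω s).iter τ) (P.H * (s + 1))) := by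
  rw [← argminOn_cube_eq _ hH]
  rfl

theorem iter_stateAt_mem_cube {n : ℕ} (P : Params n) (f : ℕ → Finset (Fin n) → ℝ) (ω : ℕ → Draw P)
    (hH : 0 < P.H) (hx₁ : P.x₁ ∈ cube n) (s τ : ℕ) : (stateAt P f ω s).iter τ ∈ cube n := by
  induction s with
  | zero => exact hx₁
  | succ s ih =>
    rw [iter_stateAt_succ P f ω hH]
    by_cases h : τ = s + 1
    · subst h
      rw [Function.update_self]
      exact cubeProj_mem_cube _ _
    · rwa [Function.update_of_ne h]

theorem iter_stateAt_of_le {n : ℕ} (P : Params n) (f : ℕ → Finset (Fin n) → ℝ) (ω : ℕ → Draw P)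
    (hH : 0 < P.H) {s τ : ℕ} (h : τ ≤ s) : (stateAt P f ω s).iter τ = runIter P f ω τ := by
  induction s, h using Nat.le_induction with
  | base => rfl
  | succ s hs ih => rw [iter_stateAt_succ P f ω hH, Function.update_of_ne (by omega), ih]

/-- The noise in the aggregate returned in round `s`. -/
noncomputable def runNoise {n : ℕ} (P : Params n) (ω : ℕ → Draw P) (s : ℕ) : Vec n :=
  ∑ j : Fin (P.depth + 1), if (s + 1).testBit j then
    (ω ((s + 1) / 2 ^ (j : ℕ) * 2 ^ (j : ℕ) - 1)).2.2 j else 0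

/-- The iterates are those of follow-the-regularized-leader with noisy sums of the estimates. -/
theorem runIter_succ {n : ℕ} (P : Params n) (f : ℕ → Finset (Fin n) → ℝ) (ω : ℕ → Draw P)
    (hH : 0 < P.H) {s : ℕ} (hs : s + 1 < 2 ^ (P.depth + 1)) :
    runIter P f ω (s + 1) =
      cubeProj (∑ τ ∈ Finset.range (s + 1), runGrad P f ω τ + runNoise P ω s) (P.H * (s + 1)) := by
  have h1 := treeOutput_eq (A := fun s => (stateAt P f ω s).tree)
    (z := fun s => runGrad P f ω s + P.H • runIter P f ω s) (ζ := fun s => (ω s).2.2) rfl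
    (tree_stateAt_succ P f ω) hs
  have h2 : ∑ τ ∈ Finset.range (s + 1), (stateAt P f ω s).iter τ
      = ∑ τ ∈ Finset.range (s + 1), runIter P f ω τ :=
    Finset.sum_congr rfl fun τ hτ =>
      iter_stateAt_of_le P f ω hH (Nat.lt_succ_iff.1 (Finset.mem_range.1 hτ))
  conv_lhs => rw [runIter, iter_stateAt_succ P f ω hH, Function.update_self]
  rw [h1, h2, Finset.sum_add_distrib, ← Finset.smul_sum]
  congr 1
  unfold runNoise
  abel

/-- The noiseless leader is fed the gradient estimates of the actual noisy run, so the two projected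
vectors differ by the noise alone. -/
theorem norm_runIter_sub_ftrl_le {n : ℕ} (P : Params n) (f : ℕ → Finset (Fin n) → ℝ)
    (ω : ℕ → Draw P) (hH : 0 < P.H) {s : ℕ} (hs : s + 1 < 2 ^ (P.depth + 1)) :
    ‖runIter P f ω (s + 1) - ftrl P.x₁ P.H (runGrad P f ω) (s + 1)‖
      ≤ ‖runNoise P ω s‖ / (P.H * (s + 1)) := by
  rw [runIter_succ P f ω hH hs, ftrl]
  refine (norm_cubeProj_sub_le _ _ (by positivity)).trans_eq ?_
  rw [add_sub_cancel_left]

theorem norm_runNoise_le {n : ℕ} (P : Params n) (ω : ℕ → Draw P) (s : ℕ) :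
    ‖runNoise P ω s‖ ≤ ∑ j : Fin (P.depth + 1),
      ‖(ω ((s + 1) / 2 ^ (j : ℕ) * 2 ^ (j : ℕ) - 1)).2.2 j‖ := by
  refine (norm_sum_le _ _).trans (Finset.sum_le_sum fun j _ => ?_)
  split_ifs
  · exact le_rfl
  · simp

theorem order_antitone {n : ℕ} (P : Params n) (f : ℕ → Finset (Fin n) → ℝ) (ω : ℕ → Draw P)
    (hH : 0 < P.H) (hx₁ : P.x₁ ∈ cube n) (s : ℕ) :
    Antitone fun j => (stateAt P f ω s).iter s ((stateAt P f ω s).order s j) :=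
  (P.chain s).antitone _ (iter_stateAt_mem_cube P f ω hH hx₁ s s)

/-- A bound for every outcome, which lets gradients multiply the noise without any independence. -/
theorem norm_runGrad_le {n : ℕ} (P : Params n) (f : ℕ → Finset (Fin n) → ℝ) (ω : ℕ → Draw P)
    (hH : 0 < P.H) (hx₁ : P.x₁ ∈ cube n) (hγ0 : 0 < P.γ) (hγ1 : P.γ ≤ 1) {M : ℝ} {s : ℕ}
    (hM : ∀ S, f s S ∈ Set.Icc (-M) M) :
    ‖runGrad P f ω s‖ ≤ 2 * (n + 1) / P.γ * M := by
  have h1 : P.γ / (n + 1) ≤ sampleProb P.γ ((stateAt P f ω s).order s)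
      ((stateAt P f ω s).iter s) (ω s).1 :=
    le_sampleProb hγ1 (iter_stateAt_mem_cube P f ω hH hx₁ s s) (order_antitone P f ω hH hx₁ s) _
  have h2 : 0 < P.γ / (n + 1) := by positivity
  refine (norm_gradEstimate_le _ (h2.trans_le h1) _ _ _).trans ?_
  have h3 : |f s (playedSet s (stateAt P f ω s) (ω s))| ≤ M := abs_le.2 (hM _)
  have h4 : 2 * ((n : ℝ) + 1) / P.γ = 2 / (P.γ / (n + 1)) := by field_simp
  rw [h4]
  gcongr

/-- Pathwise bound for the regret of the iterates with respect to the estimated linear costs. -/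
theorem sum_inner_runGrad_le {n : ℕ} (P : Params n) (f : ℕ → Finset (Fin n) → ℝ) (ω : ℕ → Draw P)
    (hH : 0 < P.H) (hx₁ : P.x₁ ∈ cube n) {G : ℝ} (hG : ∀ s < P.T, ‖runGrad P f ω s‖ ≤ G)
    {u : Vec n} (hu : u ∈ cube n) :
    ∑ t ∈ Finset.range P.T, inner ℝ (runGrad P f ω t) (runIter P f ω t - u) ≤
      ∑ t ∈ Finset.range P.T, (G + P.H * √n) ^ 2 / (2 * P.H * (t + 1)) + P.H * P.T / 2 * n +
      ∑ t ∈ Finset.range P.T, G / (P.H * (t + 1)) * ∑ j : Fin (P.depth + 1),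
        ‖(ω ((t + 1) / 2 ^ (j : ℕ) * 2 ^ (j : ℕ) - 1)).2.2 j‖ := by
  set y := ftrl P.x₁ P.H (runGrad P f ω) with hy
  have h1 := ftrl_regret_le hx₁ hu hH (runGrad P f ω) P.T
  rw [← hy] at h1
  have h2 : ∑ t ∈ Finset.range P.T, ‖runGrad P f ω t + P.H • y t‖ ^ 2 / (2 * P.H * (t + 1))
      ≤ ∑ t ∈ Finset.range P.T, (G + P.H * √n) ^ 2 / (2 * P.H * (t + 1)) := by
    refine Finset.sum_le_sum fun t ht => ?_
    gcongr
    refine (norm_add_le _ _).trans (add_le_add (hG t (Finset.mem_range.1 ht)) ?_)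
    rw [norm_smul, Real.norm_eq_abs, abs_of_pos hH]
    gcongr
    exact norm_le_sqrt_of_mem_cube (ftrl_mem_cube hx₁ _ _ _)
  -- Every round number up to `T` has its binary digits within the levels of the tree.
  have hT : P.T < 2 ^ (P.depth + 1) := by
    rw [pow_succ]
    have h1 : P.T ≤ 2 ^ P.depth := Nat.le_pow_clog (by norm_num) _
    have h2 : 0 < 2 ^ P.depth := by positivity
    omega
  have h3 : ∑ t ∈ Finset.range P.T, inner ℝ (runGrad P f ω t) (runIter P f ω t - y t) ≤
      ∑ t ∈ Finset.range P.T, G / (P.H * (t + 1)) * ∑ j : Fin (P.depth + 1),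
        ‖(ω ((t + 1) / 2 ^ (j : ℕ) * 2 ^ (j : ℕ) - 1)).2.2 j‖ := by
    have hpos : ∀ t, t ∈ Finset.range P.T → 0 ≤ G / (P.H * ((t : ℝ) + 1)) *
        ∑ j : Fin (P.depth + 1), ‖(ω ((t + 1) / 2 ^ (j : ℕ) * 2 ^ (j : ℕ) - 1)).2.2 j‖ := by
      intro t ht
      have := (norm_nonneg _).trans (hG t (Finset.mem_range.1 ht))
      positivity
    rcases Nat.eq_zero_or_pos P.T with h0 | h0
    · simp [h0]
    obtain ⟨N, hN⟩ : ∃ N, P.T = N + 1 := ⟨P.T - 1, by omega⟩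
    rw [hN] at hpos ⊢ hT
    -- Iterate `t + 1` carries the noise of round `t`, and iterate `0` carries none. The sums are
    -- therefore matched with a shift by one, and the last noise term is a nonnegative surplus.
    rw [Finset.sum_range_succ', Finset.sum_range_succ]
    have hz : inner ℝ (runGrad P f ω 0) (runIter P f ω 0 - y 0) = 0 := by
      have : runIter P f ω 0 = y 0 := rfl
      rw [this, sub_self, inner_zero_right]
    rw [hz]
    refine add_le_add (Finset.sum_le_sum fun t ht => ?_) (hpos N (by simp))
    have ht := Finset.mem_range.1 ht
    have hg := hG (t + 1) (by omega)
    have hG0 := (norm_nonneg _).trans hg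
    calc inner ℝ (runGrad P f ω (t + 1)) (runIter P f ω (t + 1) - y (t + 1))
        ≤ ‖runGrad P f ω (t + 1)‖ * ‖runIter P f ω (t + 1) - y (t + 1)‖ := real_inner_le_norm _ _
      _ ≤ G * (‖runNoise P ω t‖ / (P.H * (t + 1))) := by
          gcongr
          exact norm_runIter_sub_ftrl_le P f ω hH (by omega)
      _ = G / (P.H * (t + 1)) * ‖runNoise P ω t‖ := by ring
      _ ≤ _ := by
          gcongr
          exact norm_runNoise_le P ω t
  have h4 : ∀ t, inner ℝ (runGrad P f ω t) (runIter P f ω t - u) =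
      inner ℝ (runGrad P f ω t) (runIter P f ω t - y t) + inner ℝ (runGrad P f ω t) (y t - u) := by
    intro t
    rw [← inner_add_right, sub_add_sub_cancel]
  simp only [h4, Finset.sum_add_distrib]
  linarith

/-! ### The noise -/

theorem integrableOn_pow_mul_exp (k : ℕ) {b : ℝ} (hb : 0 < b) :
    IntegrableOn (fun r : ℝ => r ^ k * Real.exp (-(r / b))) (Set.Ioi 0) := by
  have h := integrableOn_rpow_mul_exp_neg_mul_rpow (p := 1) (s := k) (b := 1 / b)
    (by have : (0 : ℝ) ≤ k := Nat.cast_nonneg k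
        linarith) one_pos (by positivity)
  refine h.congr_fun (fun r _ => ?_) measurableSet_Ioi
  simp only [Real.rpow_natCast, Real.rpow_one]
  congr 2
  ring

theorem integral_pow_mul_exp (k : ℕ) {b : ℝ} (hb : 0 < b) :
    ∫ r in Set.Ioi (0 : ℝ), r ^ k * Real.exp (-(r / b)) = b ^ (k + 1) * k.factorial := by
  have h := Real.integral_rpow_mul_exp_neg_mul_Ioi (a := k + 1) (r := 1 / b) (by positivity)
    (by positivity)
  rw [Real.Gamma_nat_eq_factorial, one_div_one_div] at h
  rw [← Real.rpow_natCast b (k + 1)]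
  push_cast
  rw [← h]
  refine setIntegral_congr_fun measurableSet_Ioi fun r _ => ?_
  simp only [add_sub_cancel_right, Real.rpow_natCast]
  congr 2
  ring

section Noise

variable {n : ℕ} {b : ℝ}

theorem integrable_norm_pow_mul_exp (hn : 0 < n) (hb : 0 < b) (k : ℕ) :
    Integrable fun y : Vec n => ‖y‖ ^ k * Real.exp (-(‖y‖ / b)) := by
  have : Nonempty (Fin n) := ⟨⟨0, hn⟩⟩
  rw [integrable_fun_norm_addHaar volume (f := fun r => r ^ k * Real.exp (-(r / b)))]
  refine (integrableOn_pow_mul_exp (n - 1 + k) hb).congr_fun (fun r _ => ?_) measurableSet_Ioi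
  simp only [finrank_euclideanSpace, Fintype.card_fin, smul_eq_mul]
  ring

/-- Polar coordinates reduce the integral to a Gamma integral. `k = 0` gives the normalization and
`k = 1` the first moment; the ratio `b * n! / (n - 1)! = n * b` is the mean norm. -/
theorem integral_norm_pow_mul_exp (hn : 0 < n) (hb : 0 < b) (k : ℕ) :
    ∫ y : Vec n, ‖y‖ ^ k * Real.exp (-(‖y‖ / b)) =
      n * (volume.real (Metric.ball (0 : Vec n) 1) * (b ^ (n + k) * (n - 1 + k).factorial)) := by
  have : Nonempty (Fin n) := ⟨⟨0, hn⟩⟩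
  rw [integral_fun_norm_addHaar volume (fun r => r ^ k * Real.exp (-(r / b)))]
  have h : ∫ r in Set.Ioi (0 : ℝ), r ^ (Module.finrank ℝ (Vec n) - 1) •
      (r ^ k * Real.exp (-(r / b))) = b ^ (n + k) * (n - 1 + k).factorial := by
    have e : n + k = n - 1 + k + 1 := by omega
    rw [e, ← integral_pow_mul_exp (n - 1 + k) hb]
    refine setIntegral_congr_fun measurableSet_Ioi fun r _ => ?_
    simp only [finrank_euclideanSpace, Fintype.card_fin, smul_eq_mul]
    ring
  rw [h]
  simp

theorem integral_exp_norm_pos (hn : 0 < n) (hb : 0 < b) :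
    0 < ∫ y : Vec n, Real.exp (-(‖y‖ / b)) := by
  have h := integral_norm_pow_mul_exp hn hb 0
  simp only [pow_zero, one_mul] at h
  rw [h]
  have hball : 0 < volume.real (Metric.ball (0 : Vec n) 1) :=
    ENNReal.toReal_pos (Metric.measure_ball_pos _ _ one_pos).ne' measure_ball_lt_top.ne
  positivity

theorem withDensity_exp_univ (hn : 0 < n) (hb : 0 < b) :
    (volume.withDensity fun y : Vec n => ENNReal.ofReal (Real.exp (-(‖y‖ / b)))) Set.univ
      = ENNReal.ofReal (∫ y : Vec n, Real.exp (-(‖y‖ / b))) := by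
  have h := integrable_norm_pow_mul_exp hn hb 0
  simp only [pow_zero, one_mul] at h
  rw [withDensity_apply _ MeasurableSet.univ, Measure.restrict_univ,
    ofReal_integral_eq_lintegral_ofReal h (Filter.Eventually.of_forall fun y => (Real.exp_pos _).le)]

theorem isProbabilityMeasure_noiseLaw (hn : 0 < n) (hb : 0 < b) :
    IsProbabilityMeasure (noiseLaw n b) := by
  constructor
  have hpos := integral_exp_norm_pos hn hb
  rw [noiseLaw, Measure.smul_apply, smul_eq_mul, withDensity_exp_univ hn hb]
  exact ENNReal.inv_mul_cancel (ENNReal.ofReal_pos.2 hpos).ne' ENNReal.ofReal_ne_top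

theorem integrable_norm_withDensity (hn : 0 < n) (hb : 0 < b) :
    Integrable (fun y : Vec n => ‖y‖)
      (volume.withDensity fun y : Vec n => ENNReal.ofReal (Real.exp (-(‖y‖ / b)))) := by
  rw [integrable_withDensity_iff (by fun_prop) (Filter.Eventually.of_forall fun _ => by simp)]
  have h := integrable_norm_pow_mul_exp hn hb 1
  refine h.congr (Filter.Eventually.of_forall fun y => ?_)
  simp [ENNReal.toReal_ofReal (Real.exp_pos _).le]

theorem integrable_norm_noiseLaw (hn : 0 < n) (hb : 0 < b) :
    Integrable (fun y : Vec n => ‖y‖) (noiseLaw n b) := by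
  have hpos := integral_exp_norm_pos hn hb
  refine (integrable_norm_withDensity hn hb).smul_measure ?_
  rw [withDensity_exp_univ hn hb]
  exact ENNReal.inv_ne_top.2 (ENNReal.ofReal_pos.2 hpos).ne'

/-- The mean norm of the noise. -/
theorem integral_norm_noiseLaw (hn : 0 < n) (hb : 0 < b) :
    ∫ y : Vec n, ‖y‖ ∂(noiseLaw n b) = n * b := by
  have hpos := integral_exp_norm_pos hn hb
  have h0 := integral_norm_pow_mul_exp hn hb 0
  have h1 := integral_norm_pow_mul_exp hn hb 1
  have hfac : (n - 1 + 1).factorial = n * (n - 1 + 0).factorial := by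
    rw [Nat.factorial_succ, Nat.sub_add_cancel hn, add_zero]
  rw [hfac, Nat.cast_mul] at h1
  simp only [pow_zero, one_mul, pow_one] at h0 h1
  have h2 : ∫ y : Vec n, ‖y‖ * Real.exp (-(‖y‖ / b))
      = n * b * ∫ y : Vec n, Real.exp (-(‖y‖ / b)) := by
    rw [h0, h1]; ring
  rw [noiseLaw, integral_smul_measure, withDensity_exp_univ hn hb,
    integral_withDensity_eq_integral_toReal_smul (by fun_prop)
      (Filter.Eventually.of_forall fun _ => by simp)]
  have h3 : ∫ y : Vec n, (ENNReal.ofReal (Real.exp (-(‖y‖ / b)))).toReal • ‖y‖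
      = ∫ y : Vec n, ‖y‖ * Real.exp (-(‖y‖ / b)) := by
    congr 1
    ext y
    rw [ENNReal.toReal_ofReal (Real.exp_pos _).le, smul_eq_mul, mul_comm]
  rw [h3, h2, ENNReal.toReal_inv, ENNReal.toReal_ofReal hpos.le, smul_eq_mul]
  field_simp

end Noise

/-! ### Measurability of the run -/

/-- The chain, the index and the sign take finitely many values; freezing them leaves functions that
are continuous or otherwise plainly measurable. -/
theorem measurable_of_finite_cases {Ω α β : Type*} [MeasurableSpace Ω] [MeasurableSpace β] [Finite α]
    {φ : Ω → α} (hφ : ∀ a, MeasurableSet {ω | φ ω = a}) {F : α → Ω → β}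
    (hF : ∀ a, Measurable (F a)) : Measurable fun ω => F (φ ω) ω := by
  intro s hs
  have : (fun ω => F (φ ω) ω) ⁻¹' s = ⋃ a, {ω | φ ω = a} ∩ F a ⁻¹' s := by
    ext ω
    simp
  rw [this]
  exact MeasurableSet.iUnion fun a => (hφ a).inter (hF a hs)

section Measurability

variable {n : ℕ} (P : Params n) (f : ℕ → Finset (Fin n) → ℝ)

theorem measurable_chainLevel (π : Equiv.Perm (Fin n)) (i : ℕ) :
    Measurable fun x : Vec n => chainLevel π x i := by
  cases i with
  | zero => exact measurable_const
  | succ j =>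
    by_cases h : j < n
    · simp only [chainLevel, h, dif_pos]
      fun_prop
    · simp only [chainLevel, h, dif_neg, not_false_eq_true]
      exact measurable_const

theorem measurable_sampleProb (γ : ℝ) (π : Equiv.Perm (Fin n)) (i : ℕ) :
    Measurable fun x : Vec n => sampleProb γ π x i := by
  unfold sampleProb chainWeight
  have h1 := measurable_chainLevel π i
  have h2 := measurable_chainLevel π (i + 1)
  fun_prop

theorem measurable_cubeProj (a : ℝ) : Measurable fun v : Vec n => cubeProj v a := by
  unfold cubeProj
  refine (WithLp.measurable_toLp 2 _).comp (measurable_pi_lambda _ fun i => ?_)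
  fun_prop

theorem measurable_gradEstimate (π : Equiv.Perm (Fin n)) (i : ℕ) (ξ : Bool) (y : ℝ) :
    Measurable fun ρ : ℝ => gradEstimate π ρ i ξ y := by
  unfold gradEstimate
  split_ifs <;> fun_prop

variable {P f} in
theorem measurableSet_order {s : ℕ}
    (h : Measurable fun ω : ℕ → Draw P => (stateAt P f ω s).iter s) (π : Equiv.Perm (Fin n)) :
    MeasurableSet {ω : ℕ → Draw P | (stateAt P f ω s).order s = π} :=
  h ((P.chain s).measurable π)

variable {P f} in
theorem measurable_runGrad_of {s : ℕ}
    (h : Measurable fun ω : ℕ → Draw P => (stateAt P f ω s).iter s) :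
    Measurable fun ω : ℕ → Draw P => runGrad P f ω s := by
  have hfst : ∀ i, MeasurableSet {ω : ℕ → Draw P | (ω s).1 = i} := fun i =>
    (measurable_fst.comp (measurable_pi_apply s)) (measurableSet_singleton i)
  have hsnd : ∀ ξ, MeasurableSet {ω : ℕ → Draw P | (ω s).2.1 = ξ} := fun ξ =>
    (measurable_fst.comp (measurable_snd.comp (measurable_pi_apply s))) (measurableSet_singleton ξ)
  unfold runGrad playedSet
  refine measurable_of_finite_cases (φ := fun ω : ℕ → Draw P => (stateAt P f ω s).order s)
    (F := fun π ω => gradEstimate π (sampleProb P.γ π ((stateAt P f ω s).iter s) (ω s).1)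
      (ω s).1 (ω s).2.1 (f s (chainSet π (ω s).1))) (measurableSet_order h) fun π => ?_
  refine measurable_of_finite_cases (φ := fun ω : ℕ → Draw P => (ω s).1)
    (F := fun i ω => gradEstimate π (sampleProb P.γ π ((stateAt P f ω s).iter s) i)
      i (ω s).2.1 (f s (chainSet π i))) hfst fun i => ?_
  refine measurable_of_finite_cases (φ := fun ω : ℕ → Draw P => (ω s).2.1)
    (F := fun ξ ω => gradEstimate π (sampleProb P.γ π ((stateAt P f ω s).iter s) i)
      i ξ (f s (chainSet π i))) hsnd fun ξ => ?_
  exact (measurable_gradEstimate π i ξ _).comp ((measurable_sampleProb P.γ π i).comp h)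

/-- A choice of minimizer carries no measurability of its own; the closed form `cubeProj` supplies
it. Tree and iterates go through one induction because each feeds the other. -/
theorem measurable_stateAt (hH : 0 < P.H) (s : ℕ) :
    (∀ τ, Measurable fun ω : ℕ → Draw P => (stateAt P f ω s).iter τ) ∧
      ∀ j k, Measurable fun ω : ℕ → Draw P => (stateAt P f ω s).tree j k := by
  induction s with
  | zero => exact ⟨fun _ => measurable_const, fun _ _ => measurable_const⟩
  | succ s ih =>
    obtain ⟨ih1, ih2⟩ := ih
    have hg := measurable_runGrad_of (ih1 s)
    have hx : Measurable fun ω : ℕ → Draw P => runIter P f ω s := ih1 s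
    have htree : ∀ j k, Measurable fun ω : ℕ → Draw P => (stateAt P f ω (s + 1)).tree j k := by
      intro j k
      simp only [tree_stateAt_succ, treeUpdate]
      have hζ : Measurable fun ω : ℕ → Draw P => (ω s).2.2 j := by fun_prop
      have hA := ih2 j k
      split_ifs
      · exact (hA.add (hg.add (hx.const_smul P.H))).add hζ
      · exact (hA.add (hg.add (hx.const_smul P.H))).add measurable_const
      · exact hA
    refine ⟨fun τ => ?_, htree⟩
    simp only [iter_stateAt_succ P f _ hH]
    by_cases h : τ = s + 1
    · subst h
      simp only [Function.update_self]
      refine (measurable_cubeProj _).comp (Measurable.sub ?_ ?_)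
      · unfold treeOutput
        refine Finset.measurable_sum _ fun j _ => ?_
        split_ifs
        · exact htree _ _
        · exact htree _ _
        · exact measurable_const
      · exact Measurable.const_smul (Finset.measurable_sum _ fun τ _ => ih1 τ) P.H
    · simp only [Function.update_of_ne h]
      exact ih1 τ

theorem measurable_runIter (hH : 0 < P.H) (s : ℕ) :
    Measurable fun ω : ℕ → Draw P => runIter P f ω s :=
  (measurable_stateAt P f hH s).1 s

theorem measurable_runGrad (hH : 0 < P.H) (s : ℕ) :
    Measurable fun ω : ℕ → Draw P => runGrad P f ω s :=
  measurable_runGrad_of ((measurable_stateAt P f hH s).1 s)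

/-- The cost incurred in round `s`. -/
noncomputable def runCost (ω : ℕ → Draw P) (s : ℕ) : ℝ :=
  f s (playedSet s (stateAt P f ω s) (ω s))

theorem measurable_runCost (hH : 0 < P.H) (s : ℕ) :
    Measurable fun ω : ℕ → Draw P => runCost P f ω s := by
  unfold runCost playedSet
  refine measurable_of_finite_cases (φ := fun ω : ℕ → Draw P => (stateAt P f ω s).order s)
    (F := fun π ω => f s (chainSet π (ω s).1))
    (measurableSet_order ((measurable_stateAt P f hH s).1 s)) fun π => ?_
  exact (measurable_of_finite fun i : Fin (n + 1) => f s (chainSet π i)).comp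
    (measurable_fst.comp (measurable_pi_apply s))

/-- The state before round `s` is determined by the earlier draws; this permits conditioning on the
past. -/
theorem stateAt_congr {ω ω' : ℕ → Draw P} {s : ℕ} (h : ∀ r < s, ω r = ω' r) :
    stateAt P f ω s = stateAt P f ω' s := by
  induction s with
  | zero => rfl
  | succ s ih =>
    simp only [stateAt, ih fun r hr => h r (by omega), h s (by omega)]

/-! ### The law of the run -/

/-- The law of the noise and the sign of one round. -/
noncomputable def auxLaw : Measure (Bool × (Fin (P.depth + 1) → Vec n)) :=
  (PMF.uniformOfFintype Bool).toMeasure.prod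
    (Measure.pi fun _ => noiseLaw n (P.L * (P.depth + 1) / P.ε))

theorem isProbabilityMeasure_auxLaw (hn : 0 < n) (hb : 0 < P.L * (P.depth + 1) / P.ε) :
    IsProbabilityMeasure (auxLaw P) := by
  have := isProbabilityMeasure_noiseLaw hn hb
  unfold auxLaw
  infer_instance

theorem lintegral_roundLaw (hn : 0 < n) (hb : 0 < P.L * (P.depth + 1) / P.ε) (s : ℕ) (σ : State P)
    {F : Draw P → ENNReal} (hF : Measurable F) :
    ∫⁻ d, F d ∂(roundLaw s σ) = ∑ i : Fin (n + 1),
      ENNReal.ofReal (sampleProb P.γ (σ.order s) (σ.iter s) i) * ∫⁻ e, F (i, e) ∂(auxLaw P) := by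
  have := isProbabilityMeasure_auxLaw P hn hb
  change ∫⁻ d, F d ∂(Measure.prod _ (auxLaw P)) = _
  rw [lintegral_prod _ hF.aemeasurable, lintegral_finsetSum_measure]
  simp

/-- The past enters only through the finitely many index probabilities. Measurability turns the
round laws into a kernel, which the `bind` in `runLaw` needs to have its intended meaning. -/
theorem measurable_roundLaw (hn : 0 < n) (hb : 0 < P.L * (P.depth + 1) / P.ε) (hH : 0 < P.H) (s : ℕ) :
    Measurable fun ω : ℕ → Draw P => roundLaw s (stateAt P f ω s) := by
  refine Measure.measurable_of_measurable_coe _ fun A hA => ?_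
  have h := fun ω : ℕ → Draw P => lintegral_roundLaw P hn hb s (stateAt P f ω s)
    (F := A.indicator 1) (measurable_one.indicator hA)
  simp only [lintegral_indicator_one hA] at h
  simp only [h]
  refine Finset.measurable_sum _ fun i _ => Measurable.mul_const ?_ _
  refine ENNReal.measurable_ofReal.comp ?_
  have hx := (measurable_stateAt P f hH s).1 s
  exact measurable_of_finite_cases (φ := fun ω : ℕ → Draw P => (stateAt P f ω s).order s)
    (F := fun π ω => sampleProb P.γ π ((stateAt P f ω s).iter s) i)
    (measurableSet_order hx) fun π => (measurable_sampleProb P.γ π i).comp hx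

end Measurability

open ProbabilityTheory in
/-- Sampling one more coordinate, as an image of a composition-product. -/
theorem bind_map_update_eq {D : Type*} [MeasurableSpace D] (μ : Measure (ℕ → D)) [SFinite μ]
    (κ : Kernel (ℕ → D) D) [IsSFiniteKernel κ] (t : ℕ) :
    (μ.bind fun ω => (κ ω).map fun d => Function.update ω t d) =
      (μ ⊗ₘ κ).map fun p => Function.update p.1 t p.2 := by
  have hU : Measurable fun p : (ℕ → D) × D => Function.update p.1 t p.2 := measurable_update'
  have hU' : ∀ ω : ℕ → D, Measurable fun d => Function.update ω t d := fun ω => measurable_update ω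
  have hm : Measurable fun ω => (κ ω).map fun d => Function.update ω t d := by
    refine Measure.measurable_of_measurable_coe _ fun A hA => ?_
    simp only [Measure.map_apply (hU' _) hA]
    exact Kernel.measurable_kernel_prodMk_left (hU hA)
  ext A hA
  rw [Measure.bind_apply hA hm.aemeasurable, Measure.map_apply hU hA,
    Measure.compProd_apply (hU hA)]
  simp only [Measure.map_apply (hU' _) hA]
  rfl

section Law

variable {n : ℕ} {P : Params n} (f : ℕ → Finset (Fin n) → ℝ)

/-- Admissible parameters. -/
structure Params.Admissible (P : Params n) : Prop where
  dim_pos : 0 < n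
  H_pos : 0 < P.H
  scale_pos : 0 < P.L * (P.depth + 1) / P.ε
  γ_pos : 0 < P.γ
  γ_le_one : P.γ ≤ 1
  start_mem : P.x₁ ∈ cube n

theorem sampleProb_stateAt_nonneg (hP : P.Admissible) (ω : ℕ → Draw P) (s i : ℕ) :
    0 ≤ sampleProb P.γ ((stateAt P f ω s).order s) ((stateAt P f ω s).iter s) i :=
  (div_nonneg hP.γ_pos.le (by positivity)).trans
    (le_sampleProb hP.γ_le_one (iter_stateAt_mem_cube P f ω hP.H_pos hP.start_mem s s)
      (order_antitone P f ω hP.H_pos hP.start_mem s) i)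

theorem isProbabilityMeasure_indexLaw (hP : P.Admissible) (ω : ℕ → Draw P) (s : ℕ) :
    IsProbabilityMeasure (∑ i : Fin (n + 1), ENNReal.ofReal
      (sampleProb P.γ ((stateAt P f ω s).order s) ((stateAt P f ω s).iter s) i) •
        Measure.dirac i) := by
  constructor
  simp only [Measure.coe_finsetSum, Measure.coe_smul, Finset.sum_apply, Pi.smul_apply,
    measure_univ, smul_eq_mul, mul_one]
  rw [← ENNReal.ofReal_sum_of_nonneg (s := Finset.univ)
    fun (i : Fin (n + 1)) _ => sampleProb_stateAt_nonneg f hP ω s i,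
    sum_sampleProb, ENNReal.ofReal_one]

theorem isProbabilityMeasure_roundLaw (hP : P.Admissible) (ω : ℕ → Draw P) (s : ℕ) :
    IsProbabilityMeasure (roundLaw s (stateAt P f ω s)) := by
  have := isProbabilityMeasure_indexLaw f hP ω s
  have := isProbabilityMeasure_auxLaw P hP.dim_pos hP.scale_pos
  change IsProbabilityMeasure (Measure.prod _ (auxLaw P))
  infer_instance

theorem map_noise_roundLaw (hP : P.Admissible) (ω : ℕ → Draw P) (s : ℕ) (j : Fin (P.depth + 1)) :
    MeasurePreserving (fun d : Draw P => d.2.2 j) (roundLaw s (stateAt P f ω s))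
      (noiseLaw n (P.L * (P.depth + 1) / P.ε)) := by
  have := isProbabilityMeasure_indexLaw f hP ω s
  have := isProbabilityMeasure_noiseLaw hP.dim_pos hP.scale_pos
  exact (measurePreserving_eval (fun _ : Fin (P.depth + 1) =>
    noiseLaw n (P.L * (P.depth + 1) / P.ε)) j).comp
      (measurePreserving_snd.comp measurePreserving_snd)

/-- The mean of a function of the index and the sign. -/
theorem integral_roundLaw (hP : P.Admissible) (ω : ℕ → Draw P) (s : ℕ) (F : Fin (n + 1) → Bool → ℝ) :
    ∫ d, F d.1 d.2.1 ∂(roundLaw s (stateAt P f ω s)) = ∑ i : Fin (n + 1),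
      sampleProb P.γ ((stateAt P f ω s).order s) ((stateAt P f ω s).iter s) i *
        ((F i true + F i false) / 2) := by
  have := isProbabilityMeasure_indexLaw f hP ω s
  have := isProbabilityMeasure_noiseLaw hP.dim_pos hP.scale_pos
  have hmp := (MeasurePreserving.id (∑ i : Fin (n + 1), ENNReal.ofReal
      (sampleProb P.γ ((stateAt P f ω s).order s) ((stateAt P f ω s).iter s) i) •
        Measure.dirac i)).prod (measurePreserving_fst
          (μ := (PMF.uniformOfFintype Bool).toMeasure)
          (ν := Measure.pi fun _ : Fin (P.depth + 1) => noiseLaw n (P.L * (P.depth + 1) / P.ε)))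
  have h1 := integral_map (μ := roundLaw s (stateAt P f ω s)) hmp.measurable.aemeasurable
    (f := fun p : Fin (n + 1) × Bool => F p.1 p.2)
    (measurable_of_finite _).aestronglyMeasurable
  have h2 := hmp.map_eq
  change Measure.map _ (roundLaw s (stateAt P f ω s)) = _ at h2
  rw [h2] at h1
  refine h1.symm.trans ?_
  rw [integral_prod _ Integrable.of_finite, integral_finsetSum_measure
    fun i _ => Integrable.of_finite.smul_measure ENNReal.ofReal_ne_top]
  refine Finset.sum_congr rfl fun i _ => ?_
  rw [integral_smul_measure, integral_dirac, PMF.integral_eq_sum,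
    ENNReal.toReal_ofReal (sampleProb_stateAt_nonneg f hP ω s i), smul_eq_mul]
  congr 1
  simp
  ring

open ProbabilityTheory in
/-- The law of one more round, as an image of a composition-product. -/
theorem exists_kernel_runLaw (hP : P.Admissible) (t : ℕ) : ∃ κ : Kernel (ℕ → Draw P) (Draw P), IsMarkovKernel κ ∧
    (∀ ω, κ ω = roundLaw t (stateAt P f ω t)) ∧ (SFinite (runLaw P f t) →
    runLaw P f (t + 1) =
      (runLaw P f t ⊗ₘ κ).map fun p => Function.update p.1 t p.2) := by
  let κ : Kernel (ℕ → Draw P) (Draw P) :=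
    ⟨fun ω => roundLaw t (stateAt P f ω t),
      measurable_roundLaw P f hP.dim_pos hP.scale_pos hP.H_pos t⟩
  have : IsMarkovKernel κ := ⟨fun ω => isProbabilityMeasure_roundLaw f hP ω t⟩
  exact ⟨κ, this, fun _ => rfl, fun _ => bind_map_update_eq (runLaw P f t) κ t⟩

theorem isProbabilityMeasure_runLaw (hP : P.Admissible) (t : ℕ) : IsProbabilityMeasure (runLaw P f t) := by
  induction t with
  | zero => exact Measure.dirac.isProbabilityMeasure
  | succ t ih =>
    obtain ⟨κ, hκ, -, h⟩ := exists_kernel_runLaw f hP t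
    rw [h inferInstance]
    exact Measure.isProbabilityMeasure_map measurable_update'.aemeasurable

/-- Integration of the last round first. -/
theorem integral_runLaw_succ (hP : P.Admissible) (t : ℕ) {φ : (ℕ → Draw P) → ℝ}
    (hφ : Integrable φ (runLaw P f (t + 1))) :
    ∫ ω, φ ω ∂(runLaw P f (t + 1)) = ∫ ω, ∫ d, φ (Function.update ω t d)
      ∂(roundLaw t (stateAt P f ω t)) ∂(runLaw P f t) := by
  have := isProbabilityMeasure_runLaw f hP t
  obtain ⟨κ, hκ, hκ', h⟩ := exists_kernel_runLaw f hP t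
  rw [h inferInstance] at hφ ⊢
  rw [integral_map measurable_update'.aemeasurable hφ.1, Measure.integral_compProd]
  · simp only [hκ']
  · exact hφ.comp_measurable measurable_update'

/-- Later rounds do not change the law of what the first `t` rounds determine. -/
theorem map_runLaw_eq (hP : P.Admissible) {E : Type*} [MeasurableSpace E] {φ : (ℕ → Draw P) → E} (hφ : Measurable φ)
    {t t' : ℕ} (htt' : t ≤ t') (hdep : ∀ r, t ≤ r → ∀ ω d, φ (Function.update ω r d) = φ ω) :
    (runLaw P f t').map φ = (runLaw P f t).map φ := by
  induction t', htt' using Nat.le_induction with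
  | base => rfl
  | succ r hr ih =>
    rw [← ih]
    have := isProbabilityMeasure_runLaw f hP r
    obtain ⟨κ, hκ, -, h⟩ := exists_kernel_runLaw f hP r
    rw [h inferInstance, Measure.map_map hφ measurable_update']
    have : (φ ∘ fun p : (ℕ → Draw P) × Draw P => Function.update p.1 r p.2) = φ ∘ Prod.fst := by
      ext p
      exact hdep r hr p.1 p.2
    rw [this, ← Measure.map_map hφ measurable_fst, ← Measure.fst, Measure.fst_compProd]

/-- Every noise vector has the prescribed law. -/
theorem map_noise_runLaw (hP : P.Admissible) {s t : ℕ} (hst : s < t) (j : Fin (P.depth + 1)) :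
    (runLaw P f t).map (fun ω => (ω s).2.2 j) = noiseLaw n (P.L * (P.depth + 1) / P.ε) := by
  have hm : Measurable fun ω : ℕ → Draw P => (ω s).2.2 j := by fun_prop
  rw [map_runLaw_eq f hP hm (Nat.succ_le_of_lt hst) fun r hr ω d => by
    rw [Function.update_of_ne (by omega)]]
  have := isProbabilityMeasure_runLaw f hP s
  obtain ⟨κ, hκ, hκ', h⟩ := exists_kernel_runLaw f hP s
  rw [h inferInstance, Measure.map_map hm measurable_update']
  ext A hA
  have hm' : Measurable fun d : Draw P => d.2.2 j := by fun_prop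
  rw [Measure.map_apply (hm.comp measurable_update') hA,
    Measure.compProd_apply ((hm.comp measurable_update') hA)]
  have hA' : ∀ ω, κ ω (Prod.mk ω ⁻¹' (((fun ω : ℕ → Draw P => (ω s).2.2 j) ∘
      fun p : (ℕ → Draw P) × Draw P => Function.update p.1 s p.2) ⁻¹' A))
        = noiseLaw n (P.L * (P.depth + 1) / P.ε) A := by
    intro ω
    rw [hκ', ← (map_noise_roundLaw f hP ω s j).measure_preimage hA.nullMeasurableSet]
    congr 1
    ext d
    simp
  simp only [hA', lintegral_const, measure_univ, mul_one]

theorem integrable_norm_noise (hP : P.Admissible) {s t : ℕ} (hst : s < t) (j : Fin (P.depth + 1)) :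
    Integrable (fun ω => ‖(ω s).2.2 j‖) (runLaw P f t) := by
  have hm : Measurable fun ω : ℕ → Draw P => (ω s).2.2 j := by fun_prop
  have h := integrable_norm_noiseLaw hP.dim_pos hP.scale_pos
  rw [← map_noise_runLaw f hP hst j] at h
  exact h.comp_measurable hm

theorem integral_norm_noise (hP : P.Admissible) {s t : ℕ} (hst : s < t) (j : Fin (P.depth + 1)) :
    ∫ ω, ‖(ω s).2.2 j‖ ∂(runLaw P f t) = n * (P.L * (P.depth + 1) / P.ε) := by
  have hm : Measurable fun ω : ℕ → Draw P => (ω s).2.2 j := by fun_prop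
  rw [← integral_norm_noiseLaw hP.dim_pos hP.scale_pos, ← map_noise_runLaw f hP hst j,
    integral_map hm.aemeasurable (by fun_prop)]

variable {f} {M : ℝ}

theorem integrable_runCost (hP : P.Admissible) {s : ℕ} (hM : ∀ S, f s S ∈ Set.Icc (-M) M) (t : ℕ) :
    Integrable (fun ω => runCost P f ω s) (runLaw P f t) := by
  have := isProbabilityMeasure_runLaw f hP t
  exact Integrable.of_bound (measurable_runCost P f hP.H_pos s).aestronglyMeasurable M
    (Filter.Eventually.of_forall fun ω => abs_le.2 (hM _))

theorem measurable_inner_runGrad (hP : P.Admissible) (s : ℕ) (u : Vec n) :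
    Measurable fun ω : ℕ → Draw P => inner ℝ (runGrad P f ω s) (runIter P f ω s - u) :=
  (measurable_runGrad P f hP.H_pos s).inner ((measurable_runIter P f hP.H_pos s).sub_const u)

theorem integrable_inner_runGrad (hP : P.Admissible) {s : ℕ} (hM : ∀ S, f s S ∈ Set.Icc (-M) M) (t : ℕ) {u : Vec n}
    (hu : u ∈ cube n) :
    Integrable (fun ω => inner ℝ (runGrad P f ω s) (runIter P f ω s - u)) (runLaw P f t) := by
  have := isProbabilityMeasure_runLaw f hP t
  refine Integrable.of_bound (measurable_inner_runGrad hP s u).aestronglyMeasurable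
    (2 * (n + 1) / P.γ * M * (√n + √n)) (Filter.Eventually.of_forall fun ω => ?_)
  have hg := norm_runGrad_le P f ω hP.H_pos hP.start_mem hP.γ_pos hP.γ_le_one hM
  refine (norm_inner_le_norm _ _).trans (mul_le_mul hg ?_ (norm_nonneg _) ((norm_nonneg _).trans hg))
  exact (norm_sub_le _ _).trans (add_le_add
    (norm_le_sqrt_of_mem_cube (iter_stateAt_mem_cube P f ω hP.H_pos hP.start_mem s s))
    (norm_le_sqrt_of_mem_cube hu))

/-- The mean regret of a round is at most the mean regret of the estimated linear cost, up to the
exploration error. -/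
theorem integral_runCost_sub_le (hP : P.Admissible) {s t : ℕ} (hst : s < t) (hf : IsSubmodular (f s))
    (hM : ∀ S, f s S ∈ Set.Icc (-M) M) (S : Finset (Fin n)) :
    ∫ ω, runCost P f ω s ∂(runLaw P f t) - f s S ≤
      ∫ ω, inner ℝ (runGrad P f ω s) (runIter P f ω s - charVec S) ∂(runLaw P f t)
        + 2 * P.γ * M := by
  have hprob := isProbabilityMeasure_runLaw f hP
  have hi1 := integrable_runCost hP hM
  have hi2 := fun r => integrable_inner_runGrad hP hM r (charVec_mem_cube S)
  let φ : (ℕ → Draw P) → ℝ := fun ω => runCost P f ω s - f s S -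
    inner ℝ (runGrad P f ω s) (runIter P f ω s - charVec S)
  have hφ : Measurable φ := ((measurable_runCost P f hP.H_pos s).sub_const _).sub
    (measurable_inner_runGrad hP s _)
  have hi : ∀ r, Integrable φ (runLaw P f r) := fun r =>
    ((hi1 r).sub (integrable_const _)).sub (hi2 r)
  have h1 : ∫ ω, φ ω ∂(runLaw P f t) = ∫ ω, runCost P f ω s ∂(runLaw P f t) - f s S -
      ∫ ω, inner ℝ (runGrad P f ω s) (runIter P f ω s - charVec S) ∂(runLaw P f t) := by
    have e1 := integral_sub ((hi1 t).sub (integrable_const (f s S))) (hi2 t)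
    have e2 := integral_sub (hi1 t) (integrable_const (μ := runLaw P f t) (f s S))
    simp only [integral_const, probReal_univ, one_smul] at e2
    rw [← e2]
    exact e1
  -- The gap `φ` depends on the first `s + 1` draws only, so its mean can be taken after round `s`,
  -- where the last draw is integrated first with the past fixed.
  have hdep : ∀ r, s + 1 ≤ r → ∀ ω d, φ (Function.update ω r d) = φ ω := by
    intro r hr ω d
    have hs : stateAt P f (Function.update ω r d) s = stateAt P f ω s :=
      stateAt_congr P f fun q hq => Function.update_of_ne (by omega) _ _
    have hd : Function.update ω r d s = ω s := Function.update_of_ne (by omega) _ _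
    simp only [φ, runCost, runGrad, runIter, hs, hd]
  have h2 : ∫ ω, φ ω ∂(runLaw P f t) = ∫ ω, φ ω ∂(runLaw P f (s + 1)) := by
    have e := map_runLaw_eq f hP hφ (Nat.succ_le_of_lt hst) hdep
    have e1 := integral_map (μ := runLaw P f t) hφ.aemeasurable
      (f := fun x : ℝ => x) measurable_id.aestronglyMeasurable
    have e2 := integral_map (μ := runLaw P f (s + 1)) hφ.aemeasurable
      (f := fun x : ℝ => x) measurable_id.aestronglyMeasurable
    rw [← e1, ← e2, e]
  have h3 : ∀ ω, ∫ d, φ (Function.update ω s d) ∂(roundLaw s (stateAt P f ω s)) ≤ 2 * P.γ * M := by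
    intro ω
    set σ := stateAt P f ω s with hσ
    set ρ := fun i : ℕ => sampleProb P.γ (σ.order s) (σ.iter s) i with hρ
    have hx := iter_stateAt_mem_cube P f ω hP.H_pos hP.start_mem s s
    have hπ := order_antitone P f ω hP.H_pos hP.start_mem s
    have e : ∀ d, φ (Function.update ω s d) = f s (chainSet (σ.order s) d.1) - f s S -
        inner ℝ (gradEstimate (σ.order s) (ρ d.1) d.1 d.2.1 (f s (chainSet (σ.order s) d.1)))
          (σ.iter s - charVec S) := by
      intro d
      have hs : stateAt P f (Function.update ω s d) s = σ :=
        stateAt_congr P f fun q hq => Function.update_of_ne (by omega) _ _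
      have hd : Function.update ω s d s = d := Function.update_self _ _ _
      simp only [φ, runCost, runGrad, runIter, hs, hd, playedSet, hρ]
    simp only [e]
    rw [integral_roundLaw f hP ω s fun i ξ => f s (chainSet (σ.order s) i) - f s S -
        inner ℝ (gradEstimate (σ.order s) (ρ i) i ξ (f s (chainSet (σ.order s) i)))
          (σ.iter s - charVec S)]
    refine le_trans (le_of_eq ?_)
      (sum_sampleProb_regret_le hP.γ_pos hP.γ_le_one hf hM hx hπ S)
    refine Finset.sum_congr rfl fun i _ => ?_
    simp only [hρ, hσ]
    ring
  have h4 : ∫ ω, φ ω ∂(runLaw P f (s + 1)) ≤ 2 * P.γ * M := by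
    rw [integral_runLaw_succ f hP s (hi _)]
    by_cases hi_round : Integrable (fun ω => ∫ d, φ (Function.update ω s d)
        ∂(roundLaw s (stateAt P f ω s))) (runLaw P f s)
    · refine (integral_mono hi_round (integrable_const _) h3).trans_eq ?_
      simp
    -- Were the conditional mean not integrable, its integral would be `0` by convention, and the
    -- bound `2γM` is nonnegative.
    · have hM0 : 0 ≤ M := by linarith [(hM S).1, (hM S).2]
      rw [integral_undef hi_round]
      have := hP.γ_pos
      positivity
  linarith

end Law

/-! ### The regret bound -/

theorem sum_one_div_add_one_le (T : ℕ) :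
    ∑ t ∈ Finset.range T, 1 / ((t : ℝ) + 1) ≤ 1 + Real.log T := by
  refine le_trans (le_of_eq ?_) (harmonic_le_one_add_log T)
  simp [harmonic]

/-- Since `2 ^ (clog 2 T - 1) < T` for `T > 1`, the depth is below `1 + log T / log 2`; the factor
`2` suffices because `log 2 ≥ 1/2`. -/
theorem depth_add_one_le {T : ℕ} (hT : 0 < T) :
    ((Nat.clog 2 T : ℕ) : ℝ) + 1 ≤ 2 * (1 + Real.log T) := by
  have hlog : 0 ≤ Real.log T := Real.log_natCast_nonneg T
  rcases Nat.lt_or_ge 1 T with h1 | h1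
  · have h2 : 2 ^ (Nat.clog 2 T - 1) < T := Nat.pow_pred_clog_lt_self (by norm_num) h1
    have h3 : ((2 : ℝ) ^ (Nat.clog 2 T - 1)) ≤ T := by exact_mod_cast h2.le
    have h4 := Real.log_le_log (by positivity) h3
    rw [Real.log_pow] at h4
    have h5 : 1 ≤ Nat.clog 2 T := Nat.clog_pos (by norm_num) h1
    rw [Nat.cast_sub h5, Nat.cast_one] at h4
    have h6 : (1 : ℝ) ≤ Nat.clog 2 T := by exact_mod_cast h5
    have h7 := Real.log_two_gt_d9
    nlinarith
  · have : T = 1 := by omega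
    subst this
    norm_num

/-- The regret bound in terms of a bound `G` for the gradient estimates. -/
theorem integral_regret_le {n : ℕ} {P : Params n} (hP : P.Admissible)
    {f : ℕ → Finset (Fin n) → ℝ} {M G : ℝ} (hT : 0 < P.T)
    (hG0 : 2 * (n + 1) / P.γ * M ≤ G)
    (hf : ∀ t < P.T, IsSubmodular (f t) ∧ ∀ S, f t S ∈ Set.Icc (-M) M) :
    Integrable (regret P f) (runLaw P f P.T) ∧
    ∫ ω, regret P f ω ∂(runLaw P f P.T) ≤
      (G + P.H * √n) ^ 2 / (2 * P.H) * (1 + Real.log P.T) + P.H * P.T / 2 * n +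
        G / P.H * (1 + Real.log P.T) *
          ((P.depth + 1) * (n * (P.L * (P.depth + 1) / P.ε))) + P.T * (2 * P.γ * M) := by
  have hprob := isProbabilityMeasure_runLaw f hP P.T
  have hH := hP.H_pos
  -- The costs are fixed in advance, so the best set is deterministic and can be chosen before
  -- taking means.
  obtain ⟨S, -, hS⟩ := Finset.exists_mem_eq_inf' (Finset.univ_nonempty)
    fun S : Finset (Fin n) => ∑ t ∈ Finset.range P.T, f t S
  have hreg : regret P f = fun ω => ∑ t ∈ Finset.range P.T, runCost P f ω t -
      ∑ t ∈ Finset.range P.T, f t S := by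
    ext ω
    rw [regret, hS]
    rfl
  have hG : ∀ ω, ∀ s < P.T, ‖runGrad P f ω s‖ ≤ G := fun ω s hs =>
    (norm_runGrad_le P f ω hH hP.start_mem hP.γ_pos hP.γ_le_one (hf s hs).2).trans hG0
  have hi1 : ∀ t ∈ Finset.range P.T, Integrable (fun ω => runCost P f ω t) (runLaw P f P.T) :=
    fun t ht => integrable_runCost hP (hf t (Finset.mem_range.1 ht)).2 _
  have hi2 : ∀ t ∈ Finset.range P.T, Integrable
      (fun ω => inner ℝ (runGrad P f ω t) (runIter P f ω t - charVec S)) (runLaw P f P.T) :=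
    fun t ht => integrable_inner_runGrad hP (hf t (Finset.mem_range.1 ht)).2 _ (charVec_mem_cube S)
  rw [hreg]
  refine ⟨(integrable_finsetSum _ hi1).sub (integrable_const _), ?_⟩
  have h1 : ∫ ω, (∑ t ∈ Finset.range P.T, runCost P f ω t - ∑ t ∈ Finset.range P.T, f t S)
      ∂(runLaw P f P.T) = ∑ t ∈ Finset.range P.T,
        (∫ ω, runCost P f ω t ∂(runLaw P f P.T) - f t S) := by
    rw [integral_sub (integrable_finsetSum _ hi1) (integrable_const _), integral_finsetSum _ hi1,
      Finset.sum_sub_distrib]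
    simp
  have h2 : ∑ t ∈ Finset.range P.T, (∫ ω, runCost P f ω t ∂(runLaw P f P.T) - f t S) ≤
      ∫ ω, ∑ t ∈ Finset.range P.T, inner ℝ (runGrad P f ω t) (runIter P f ω t - charVec S)
        ∂(runLaw P f P.T) + P.T * (2 * P.γ * M) := by
    rw [integral_finsetSum _ hi2]
    have e : (P.T : ℝ) * (2 * P.γ * M) = ∑ t ∈ Finset.range P.T, 2 * P.γ * M := by simp
    rw [e, ← Finset.sum_add_distrib]
    refine Finset.sum_le_sum fun t ht => ?_
    have ht' := Finset.mem_range.1 ht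
    exact integral_runCost_sub_le hP ht' (hf t ht').1 (hf t ht').2 S
  have hidx : ∀ t ∈ Finset.range P.T, ∀ j : ℕ, (t + 1) / 2 ^ j * 2 ^ j - 1 < P.T := by
    intro t ht j
    have ht' := Finset.mem_range.1 ht
    have := Nat.div_mul_le_self (t + 1) (2 ^ j)
    omega
  have hi3 : ∀ t ∈ Finset.range P.T, Integrable (fun ω : ℕ → Draw P =>
      G / (P.H * (t + 1)) * ∑ j : Fin (P.depth + 1),
        ‖(ω ((t + 1) / 2 ^ (j : ℕ) * 2 ^ (j : ℕ) - 1)).2.2 j‖) (runLaw P f P.T) := fun t ht =>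
    (integrable_finsetSum _ fun (j : Fin (P.depth + 1)) _ =>
      integrable_norm_noise f hP (hidx t ht j) j).const_mul _
  have h3 : ∫ ω, ∑ t ∈ Finset.range P.T, inner ℝ (runGrad P f ω t) (runIter P f ω t - charVec S)
      ∂(runLaw P f P.T) ≤
      ∑ t ∈ Finset.range P.T, (G + P.H * √n) ^ 2 / (2 * P.H * (t + 1)) + P.H * P.T / 2 * n +
      ∑ t ∈ Finset.range P.T, G / (P.H * (t + 1)) *
        ((P.depth + 1) * (n * (P.L * (P.depth + 1) / P.ε))) := by
    have hm := integral_mono (integrable_finsetSum _ hi2)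
      ((integrable_const (∑ t ∈ Finset.range P.T, (G + P.H * √n) ^ 2 / (2 * P.H * (t + 1)) +
        P.H * P.T / 2 * n)).add (integrable_finsetSum _ hi3))
      fun ω => sum_inner_runGrad_le P f ω hH hP.start_mem (hG ω) (charVec_mem_cube S)
    refine hm.trans_eq ?_
    have e := integral_add (integrable_const (μ := runLaw P f P.T)
      (∑ t ∈ Finset.range P.T, (G + P.H * √n) ^ 2 / (2 * P.H * (t + 1)) +
        P.H * P.T / 2 * n)) (integrable_finsetSum _ hi3)
    refine e.trans ?_
    rw [integral_finsetSum _ hi3]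
    simp only [integral_const, probReal_univ, one_smul]
    congr 1
    refine Finset.sum_congr rfl fun t ht => ?_
    rw [integral_const_mul, integral_finsetSum _ fun (j : Fin (P.depth + 1)) _ =>
      integrable_norm_noise f hP (hidx t ht j) j]
    simp only [integral_norm_noise f hP (hidx t ht _)]
    simp
  have hh := sum_one_div_add_one_le P.T
  have h4 : ∑ t ∈ Finset.range P.T, (G + P.H * √n) ^ 2 / (2 * P.H * ((t : ℝ) + 1)) ≤
      (G + P.H * √n) ^ 2 / (2 * P.H) * (1 + Real.log P.T) := by
    refine le_trans (le_of_eq ?_) (mul_le_mul_of_nonneg_left hh (by positivity))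
    rw [Finset.mul_sum]
    refine Finset.sum_congr rfl fun t _ => ?_
    field_simp
  have hGnn : 0 ≤ G := (norm_nonneg _).trans (hG (fun _ => (0, true, 0)) 0 hT)
  have hb := hP.scale_pos
  have h5 : ∑ t ∈ Finset.range P.T, G / (P.H * ((t : ℝ) + 1)) *
        ((P.depth + 1) * (n * (P.L * (P.depth + 1) / P.ε))) ≤
      G / P.H * (1 + Real.log P.T) * ((P.depth + 1) * (n * (P.L * (P.depth + 1) / P.ε))) := by
    rw [← Finset.sum_mul]
    refine mul_le_mul_of_nonneg_right ?_ (by positivity)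
    refine le_trans (le_of_eq ?_) (mul_le_mul_of_nonneg_left hh (by positivity))
    rw [Finset.mul_sum]
    refine Finset.sum_congr rfl fun t _ => ?_
    field_simp
  rw [h1]
  linarith

/-- Arithmetic of the rates: `q = T ^ (1/4)`, `r = √n`, `l = 1 + log T`, `D` is the number of levels
of the tree and `E = max 1 (1 / ε)`. -/
theorem rate_bound {c₁ c₂ M H L ε q r l D E : ℝ} (hc₁ : 0 < c₁) (hc₂ : 0 < c₂) (hM : 0 < M)
    (hε : 0 < ε) (hq : 1 ≤ q) (hr : 1 ≤ r) (hl : 1 ≤ l) (hD0 : 0 ≤ D) (hD : D ≤ 2 * l)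
    (hE1 : 1 ≤ E) (hEε : 1 / ε ≤ E) (hH1 : c₁ * (M / (r * q)) ≤ H) (hH2 : H ≤ c₂ * (M / (r * q)))
    (hL : L = 4 * M + 2 * H * r) :
    (4 * M * q + H * r) ^ 2 / (2 * H) * l + H * q ^ 4 / 2 * r ^ 2 +
        4 * M * q / H * l * (D * (r ^ 2 * (L * D / ε))) + q ^ 4 * (2 * (r ^ 2 / q) * M) ≤
      (2 + c₂ / 2 + (4 + c₂) ^ 2 / (2 * c₁) + 16 * (4 + 2 * c₂) / c₁) * l ^ 3 *
        (M * r ^ 3 * q ^ 3 * E) := by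
  have hq0 : 0 < q := by linarith
  have hr0 : 0 < r := by linarith
  have hl0 : 0 < l := by linarith
  have hE0 : 0 < E := by linarith
  have hHpos : 0 < H := lt_of_lt_of_le (by positivity) hH1
  have hl3 : 1 ≤ l ^ 3 := one_le_pow₀ hl
  have hHr : H * r ≤ c₂ * M := by
    calc H * r ≤ c₂ * (M / (r * q)) * r := by gcongr
      _ = c₂ * M / q := by field_simp
      _ ≤ c₂ * M := div_le_self (by positivity) hq
  have hinv : 1 / H ≤ r * q / (c₁ * M) := by
    rw [div_le_div_iff₀ hHpos (by positivity)]
    have e : c₁ * (M / (r * q)) * (r * q) = c₁ * M := by field_simp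
    nlinarith [mul_le_mul_of_nonneg_right hH1 (show 0 ≤ r * q by positivity)]
  have hMq : M ≤ M * q := le_mul_of_one_le_right hM.le hq
  have t1 : (4 * M * q + H * r) ^ 2 / (2 * H) * l ≤
      (4 + c₂) ^ 2 / (2 * c₁) * l ^ 3 * (M * r ^ 3 * q ^ 3 * E) := by
    have h1 : 4 * M * q + H * r ≤ (4 + c₂) * (M * q) := by nlinarith
    calc (4 * M * q + H * r) ^ 2 / (2 * H) * l
        = (4 * M * q + H * r) ^ 2 / 2 * (1 / H) * l := by field_simp
      _ ≤ ((4 + c₂) * (M * q)) ^ 2 / 2 * (r * q / (c₁ * M)) * l := by gcongr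
      _ = (4 + c₂) ^ 2 / (2 * c₁) * (l ^ 1) * (M * r ^ 1 * q ^ 3 * 1) := by field_simp
      _ ≤ _ := by gcongr <;> norm_num
  have t2 : H * q ^ 4 / 2 * r ^ 2 ≤ c₂ / 2 * l ^ 3 * (M * r ^ 3 * q ^ 3 * E) := by
    calc H * q ^ 4 / 2 * r ^ 2 ≤ c₂ * (M / (r * q)) * q ^ 4 / 2 * r ^ 2 := by gcongr
      _ = c₂ / 2 * 1 * (M * r ^ 1 * q ^ 3 * 1) := by field_simp
      _ ≤ _ := by gcongr; norm_num
  -- The only term with three logarithms and with `1 / ε`: one factor `l` is the harmonic sum, one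
  -- `D` counts the noise vectors in an aggregate, the other sits in the noise scale. It alone needs
  -- `r ^ 3`.
  have t3 : 4 * M * q / H * l * (D * (r ^ 2 * (L * D / ε))) ≤
      16 * (4 + 2 * c₂) / c₁ * l ^ 3 * (M * r ^ 3 * q ^ 3 * E) := by
    have hL0 : 0 < L := by rw [hL]; positivity
    have hL1 : L ≤ (4 + 2 * c₂) * M := by rw [hL]; linarith
    calc 4 * M * q / H * l * (D * (r ^ 2 * (L * D / ε)))
        = 4 * M * q * (1 / H) * l * (D * (r ^ 2 * (L * D * (1 / ε)))) := by field_simp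
      _ ≤ 4 * M * q * (r * q / (c₁ * M)) * l *
          (2 * l * (r ^ 2 * ((4 + 2 * c₂) * M * (2 * l) * E))) := by gcongr
      _ = 16 * (4 + 2 * c₂) / c₁ * l ^ 3 * (M * r ^ 3 * q ^ 2 * E) := by field_simp; ring
      _ ≤ _ := by gcongr; norm_num
  have t4 : q ^ 4 * (2 * (r ^ 2 / q) * M) ≤ 2 * l ^ 3 * (M * r ^ 3 * q ^ 3 * E) := by
    calc q ^ 4 * (2 * (r ^ 2 / q) * M) = 2 * 1 * (M * r ^ 2 * q ^ 3 * 1) := by field_simp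
      _ ≤ _ := by gcongr; norm_num
  linarith

end BanditSubmodular

theorem theorem4 :
    ∃ k : ℕ, ∀ c₁ c₂ : ℝ, 0 < c₁ → c₁ ≤ c₂ → ∃ C : ℝ, 0 < C ∧
      ∀ (n T : ℕ) (M ε H L γ : ℝ) (x₁ : Vec n) (chain : ℕ → ChainRule n)
        (f : ℕ → Finset (Fin n) → ℝ),
        0 < n → 0 < T → 0 < M → 0 < ε →
        γ = n / (T : ℝ) ^ (1 / 4 : ℝ) → γ ≤ 1 →
        c₁ * (M / (√n * (T : ℝ) ^ (1 / 4 : ℝ))) ≤ H →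
        H ≤ c₂ * (M / (√n * (T : ℝ) ^ (1 / 4 : ℝ))) →
        L = 4 * M + 2 * H * √n →
        x₁ ∈ cube n →
        (∀ t < T, IsSubmodular (f t) ∧ ∀ S, f t S ∈ Set.Icc (-M) M) →
        let P : Params n := ⟨T, H, L, ε, γ, x₁, chain⟩
        IsProbabilityMeasure (runLaw P f T) ∧
        Integrable (regret P f) (runLaw P f T) ∧
        ∫ ω, regret P f ω ∂(runLaw P f T) ≤
          C * (1 + Real.log T) ^ k *
            (M * (n : ℝ) ^ (3 / 2 : ℝ) * (T : ℝ) ^ (3 / 4 : ℝ) * max 1 (1 / ε)) := by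
  refine ⟨3, fun c₁ c₂ hc₁ hc₁₂ => ?_⟩
  have hc₂ : 0 < c₂ := hc₁.trans_le hc₁₂
  -- The summands are the constants of exploration, regularization, stability and noise, in this
  -- order.
  refine ⟨2 + c₂ / 2 + (4 + c₂) ^ 2 / (2 * c₁) + 16 * (4 + 2 * c₂) / c₁, by positivity, ?_⟩
  intro n T M ε H L γ x₁ chain f hn hT hM hε hγ hγ1 hH1 hH2 hL hx₁ hf P
  set q : ℝ := (T : ℝ) ^ (1 / 4 : ℝ) with hq
  set r : ℝ := √n with hr
  have hn1 : (1 : ℝ) ≤ n := by exact_mod_cast hn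
  have hT1 : (1 : ℝ) ≤ T := by exact_mod_cast hT
  have hT0 : (0 : ℝ) ≤ T := by linarith
  have hq1 : 1 ≤ q := Real.one_le_rpow hT1 (by norm_num)
  have hr1 : 1 ≤ r := Real.one_le_sqrt.2 hn1
  have hq0 : 0 < q := by linarith
  have hr0 : 0 < r := by linarith
  have hq4 : (T : ℝ) = q ^ 4 := by
    rw [hq, ← Real.rpow_natCast, ← Real.rpow_mul hT0]; norm_num
  have hq3 : (T : ℝ) ^ (3 / 4 : ℝ) = q ^ 3 := by
    rw [hq, ← Real.rpow_natCast, ← Real.rpow_mul hT0]; norm_num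
  have hr2 : (n : ℝ) = r ^ 2 := (Real.sq_sqrt (by linarith)).symm
  have hr3 : (n : ℝ) ^ (3 / 2 : ℝ) = r ^ 3 := by
    rw [hr, Real.sqrt_eq_rpow, ← Real.rpow_natCast, ← Real.rpow_mul (by linarith)]; norm_num
  have hHpos : 0 < H := lt_of_lt_of_le (by positivity) hH1
  have hγ0 : 0 < γ := by rw [hγ]; positivity
  have hLpos : 0 < L := by rw [hL]; positivity
  have hP : P.Admissible := ⟨hn, hHpos, by change 0 < L * _ / ε; positivity, hγ0, hγ1, hx₁⟩
  -- The factor `n` in `γ` absorbs the number `n + 1 ≤ 2 n` of chain sets, so the gradient bound is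
  -- free of the dimension.
  have hG : 2 * ((n : ℝ) + 1) / γ * M ≤ 4 * M * q := by
    rw [hγ]
    have : 2 * ((n : ℝ) + 1) / (n / q) * M = 2 * (n + 1) / n * (M * q) := by field_simp
    rw [this]
    have h2 : 2 * ((n : ℝ) + 1) / n ≤ 4 := by
      rw [div_le_iff₀ (by linarith)]; linarith
    nlinarith [mul_le_mul_of_nonneg_right h2 (show 0 ≤ M * q by positivity)]
  obtain ⟨hreg_int, hle⟩ := integral_regret_le hP hT hG hf
  refine ⟨isProbabilityMeasure_runLaw f hP T, hreg_int, hle.trans ?_⟩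
  have hl : 1 ≤ 1 + Real.log T := by linarith [Real.log_natCast_nonneg T]
  have key := rate_bound hc₁ hc₂ hM hε hq1 hr1 hl (by positivity) (depth_add_one_le hT)
    (le_max_left 1 (1 / ε)) (le_max_right 1 (1 / ε)) hH1 hH2 hL
  rw [hq3, hr3]
  refine le_trans (le_of_eq ?_) key
  rw [← hr2, ← hq4]
  change _ + H * T / 2 * n + _ + T * (2 * γ * M) = _
  rw [hγ]
  rfl
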